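/- **Proposition 3.3.** Let $n\ge 1$, $T>0$, $-\tfrac12<\kappa<0$, $c>0$. On $\mathbb R^{1+n}$ with coordinates $(t,x)$ let $g$ be the Minkowski metric $-dt^2+dx_1^2+\dots+dx_n^2$, with covariant derivative $\nabla$ and wave operator $\Box=g^{\alpha\beta}\nabla_{\alpha\beta}$; indices are raised and lowered with $g$, and repeated indices are summed. Let $r=|x|$, $y=1-r$, let $\partial_r=(0,x/|x|)$, and let $|\slashed\nabla u|$ be the length of the angular gradient of $u$, i.e. of the component of its spatial gradient tangent to the spheres of constant $t$ and $r$. Put $$D\Phi=y^{\kappa}\nabla(y^{-\kappa}\Phi),\qquad \bar D\Phi=y^{-\kappa}\nabla(y^{\kappa}\Phi),\qquad \Box_y=g^{\alpha\beta}\bar D_\alpha D_\beta ,\qquad D_X=X^\alpha D_\alpha,\qquad D_r=D_{\partial_r},$$ $$f=-\frac{1}{1+2\kappa}\,y^{1+2\kappa}-ct^2,\qquad z=-4c,$$ $$w_{f,z}=\frac12\Big(\Box f+\frac{2\kappa}{y}\nabla_\alpha y\nabla^\alpha f\Big)+z,\qquad S_{f,z}=\nabla^\alpha f\cdot D_\alpha+w_{f,z}.$$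 Let $\mathcal C=(-T,T)\times\{|x|<1\}$, and for $0<\varepsilon<\tfrac12$ let $$\mathcal C_\varepsilon=(-T,T)\times\{\varepsilon<r<1-\varepsilon\},\qquad \Gamma_\varepsilon=\big[(-T,T)\times\{r=\varepsilon\}\big]\cup\big[(-T,T)\times\{r=1-\varepsilon\}\big],$$ and let $\nu$ be the outward unit normal of $\mathcal C_\varepsilon$ on $\Gamma_\varepsilon$ (so $\nu=-\partial_r$ on $\{r=\varepsilon\}$ and $\nu=\partial_r$ on $\{r=1-\varepsilon\}$). Integrals over $\mathcal C_\varepsilon$ and $\Gamma_\varepsilon$ are with respect to the volumes induced by $g$. Let $u\in C^\infty(\mathcal C)$ be real-valued and supported on $\mathcal C\cap\{|t|<T-\delta\}$ for some $\delta>0$. Then, for every $0<\varepsilon<\tfrac12$, $$\begin{aligned} -\int_{\mathcal C_\varepsilon}\Box_y u\cdot S_{f,z}u\ \ge\ &\int_{\mathcal C_\varepsilon}\big[(1-4c)|\slashed\nabla u|^2+2c(\partial_tu)^2-4c(D_ru)^2\big]\\ &-\frac12(n-1)\kappa\int_{\mathcal C_\varepsilon}y^{2\kappa-2}r^{-2}\,[\,r-(n-4)y\,]\,u^2\\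 &+\frac14(n-1)(n-3)\int_{\mathcal C_\varepsilon}y^{2\kappa}r^{-3}u^2-\int_{\Gamma_\varepsilon}S_{f,z}u\cdot D_\nu u\\ &+\frac12\int_{\Gamma_\varepsilon}\nabla_\nu f\cdot D_\beta u\,D^\beta u+\frac12\int_{\Gamma_\varepsilon}\nabla_\nu w_{f,z}\cdot u^2\\ &+2\kappa(2\kappa-1)\int_{\Gamma_\varepsilon}y^{2\kappa-2}\,\nabla_\nu y\cdot u^2 . \end{aligned}$$ -/

import Mathlib

open MeasureTheory Set
open scoped ContDiff

namespace TwistedWave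

noncomputable section

/-- The spacetime `ℝ^{1+n}`; a point is `p = (t, x)`, with `x` in Euclidean `n`-space. -/
abbrev Spacetime (n : ℕ) : Type := ℝ × EuclideanSpace ℝ (Fin n)

/-- The Cartesian coordinate frame: index `0` is `∂_t`, index `i + 1` is `∂_{x_i}`.
This frame is parallel for the Minkowski metric, so the components of covariant derivatives
in it are ordinary partial derivatives of components. -/
def frame (n : ℕ) : Fin (n + 1) → Spacetime n :=
  Fin.cons (1, 0) (fun i => (0, EuclideanSpace.single i 1))

/-- The Minkowski metric `diag(-1, 1, …, 1)` in the Cartesian frame. -/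
def minkowski (n : ℕ) : Matrix (Fin (n + 1)) (Fin (n + 1)) ℝ :=
  Matrix.diagonal (Fin.cons (-1) (fun _ => 1))

/-- The Minkowski matrix is its own inverse, so it gives `g_{αβ}` as well as `g^{αβ}`. -/
theorem minkowski_mul_self (n : ℕ) : minkowski n * minkowski n = 1 := by
  rw [minkowski, Matrix.diagonal_mul_diagonal, ← Matrix.diagonal_one]
  congr 1
  funext i
  refine Fin.cases ?_ (fun j => ?_) i <;> simp

/-- The `g`-contraction `g^{αβ} a_α b_β` of two covectors. -/
def contract {n : ℕ} (a b : Spacetime n →L[ℝ] ℝ) : ℝ :=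
  ∑ α, ∑ β, minkowski n α β * a (frame n α) * b (frame n β)

/-- The wave operator `□φ = g^{αβ} ∂_α ∂_β φ`. -/
def waveOp {n : ℕ} (φ : Spacetime n → ℝ) (p : Spacetime n) : ℝ :=
  ∑ α, ∑ β, minkowski n α β *
    fderiv ℝ (fun q => fderiv ℝ φ q (frame n β)) p (frame n α)

/-- `y = 1 - r`, where `r = |x|`. -/
def yFun {n : ℕ} (p : Spacetime n) : ℝ := 1 - ‖p.2‖

/-- The twisted differential `Dφ = y^κ ∇(y^{-κ} φ)` of a scalar function;
`twistedD κ φ p X` is `D_X φ` at `p`. -/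
def twistedD {n : ℕ} (κ : ℝ) (φ : Spacetime n → ℝ) (p : Spacetime n) : Spacetime n →L[ℝ] ℝ :=
  yFun p ^ κ • fderiv ℝ (fun q => yFun q ^ (-κ) * φ q) p

/-- The conjugate twisted differential `D̄φ = y^{-κ} ∇(y^κ φ)`. -/
def twistedDbar {n : ℕ} (κ : ℝ) (φ : Spacetime n → ℝ) (p : Spacetime n) :
    Spacetime n →L[ℝ] ℝ :=
  yFun p ^ (-κ) • fderiv ℝ (fun q => yFun q ^ κ * φ q) p

/-- The twisted wave operator `□_y u = g^{αβ} D̄_α D_β u`. -/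
def twistedWaveOp {n : ℕ} (κ : ℝ) (u : Spacetime n → ℝ) (p : Spacetime n) : ℝ :=
  ∑ α, ∑ β, minkowski n α β *
    twistedDbar κ (fun q => twistedD κ u q (frame n β)) p (frame n α)

/-- The time derivative `∂_t u`. -/
def timeDeriv {n : ℕ} (u : Spacetime n → ℝ) (p : Spacetime n) : ℝ := fderiv ℝ u p (1, 0)

/-- The radial vector field `∂_r = (0, x / |x|)`. -/
def radial {n : ℕ} (p : Spacetime n) : Spacetime n := (0, ‖p.2‖⁻¹ • p.2)

/-- The angular gradient: the component of the spatial gradient tangent to the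
sphere through `p` on which `t` and `r` are constant. -/
def angularGrad {n : ℕ} (u : Spacetime n → ℝ) (p : Spacetime n) : EuclideanSpace ℝ (Fin n) :=
  (ℝ ∙ p.2)ᗮ.starProjection (gradient (fun x => u (p.1, x)) p.2)

/-- `w_{f,z} = (1/2) (□f + (2κ/y) ∇_α y ∇^α f) + z`. -/
def wFun {n : ℕ} (κ : ℝ) (f z : Spacetime n → ℝ) (p : Spacetime n) : ℝ :=
  (1 / 2) * (waveOp f p + 2 * κ / yFun p * contract (fderiv ℝ yFun p) (fderiv ℝ f p)) + z p

/-- The multiplier `S_{f,z} u = ∇^α f D_α u + w_{f,z} u`. -/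
def multiplier {n : ℕ} (κ : ℝ) (f z u : Spacetime n → ℝ) (p : Spacetime n) : ℝ :=
  contract (fderiv ℝ f p) (twistedD κ u p) + wFun κ f z p * u p

/-- `f = -y^{1+2κ} / (1+2κ) - c t²`. -/
def fFun {n : ℕ} (κ c : ℝ) (p : Spacetime n) : ℝ :=
  -(1 / (1 + 2 * κ)) * yFun p ^ (1 + 2 * κ) - c * p.1 ^ 2

/-- `z = -4c`. -/
def zFun {n : ℕ} (c : ℝ) (_p : Spacetime n) : ℝ := -4 * c

/-- The cylinder `𝒞 = (-T, T) × B_1`. -/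
def cylinder (n : ℕ) (T : ℝ) : Set (Spacetime n) :=
  {p | p.1 ∈ Ioo (-T) T ∧ ‖p.2‖ < 1}

/-- The truncated cylinder `𝒞_ε = (-T, T) × {ε < r < 1 - ε}`. -/
def cylinderEps (n : ℕ) (T ε : ℝ) : Set (Spacetime n) :=
  {p | p.1 ∈ Ioo (-T) T ∧ ‖p.2‖ ∈ Ioo ε (1 - ε)}

/-- The outward unit normal of `𝒞_ε` along its timelike boundary `Γ_ε`:
`-∂_r` on the inner component `{r = ε}` and `∂_r` on the outer component `{r = 1 - ε}`. -/
def outwardNormal {n : ℕ} (ε : ℝ) (p : Spacetime n) : Spacetime n :=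
  if ‖p.2‖ = ε then -radial p else radial p

/-- The integral of `F` over `(-T, T) × {r = ρ}` with respect to the induced volume,
which is `ρ^{n-1} dθ dt` in polar coordinates. -/
def lateralIntegral {n : ℕ} (T ρ : ℝ) (F : Spacetime n → ℝ) : ℝ :=
  ∫ t in Ioo (-T) T, ρ ^ (n - 1) *
    ∫ θ : Metric.sphere (0 : EuclideanSpace ℝ (Fin n)) 1,
      F (t, ρ • (θ : EuclideanSpace ℝ (Fin n))) ∂(volume.toSphere)

/-- The integral over `Γ_ε`, the union of `(-T, T) × {r = ε}` and `(-T, T) × {r = 1 - ε}`. -/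
def gammaIntegral {n : ℕ} (T ε : ℝ) (F : Spacetime n → ℝ) : ℝ :=
  lateralIntegral T ε F + lateralIntegral T (1 - ε) F

end

end TwistedWave

open TwistedWave

/-!
The current `-S u · D_α u + ½ ∇_α f · D_β u D^β u + ½ ∇_α w · u²` has divergence
`-□_y u · S u - ∇²f(Du, Du) - z D_β u D^β u` plus a multiple of `u²`. For the given `f` the Hessian
is `(y^{2κ} / r) (dx² - dr²) - 2κ y^{2κ-1} dr² - 2c dt²`. Since `κ ≤ 0` and `r < 1`, the angular
weight `y^{2κ} / r` is at least `1`. The `y^{2κ-3} u²` term has the wrong sign but is absorbed by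
the radial part: up to the divergence of `2κ(2κ-1) y^{2κ-2} u² ∇y` the two add up to
`-2κ y^{2κ-1} (D_r u + (1 - 2κ) u / y)²`, which is nonnegative (Hardy's inequality). Integrating
over `𝒞_ε` turns both divergences into the integrals over `Γ_ε`.
-/

open Filter Topology

namespace TwistedWave

section WeakDerivative

variable {g h m : ℝ → ℝ} {a b : ℝ}

theorem eqOn_zero_of_integral_sq_eq_zero (hg : Continuous g) (hab : a < b)
    (h0 : ∫ r in a..b, g r ^ 2 = 0) : EqOn g 0 (Icc a b) := by
  intro r hr
  by_contra hne
  exact h0.not_gt <| intervalIntegral.integral_pos hab (by fun_prop) (fun _ _ => sq_nonneg _)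
    ⟨r, hr, sq_pos_of_ne_zero hne⟩

-- With `H` the primitive of `h`, testing against a primitive of `m - H` gives `∫ (m - H)² = 0`.
theorem integral_eq_of_forall_integral_mul_add_deriv_mul_eq_zero (hh : Continuous h)
    (hm : Continuous m) (hab : a < b)
    (hweak : ∀ φ : ℝ → ℝ, ContDiff ℝ 1 φ → ∫ r in a..b, (φ r * h r + deriv φ r * m r) = 0)
    {r : ℝ} (hr : r ∈ Icc a b) : ∫ s in a..r, h s = m r := by
  set H : ℝ → ℝ := fun r => ∫ s in a..r, h s
  have hasDeriv_H (r : ℝ) : HasDerivAt H (h r) r := (hh.integral_hasStrictDerivAt a r).hasDerivAt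
  have hH : Continuous H := continuous_iff_continuousAt.2 fun r => (hasDeriv_H r).continuousAt
  have hHa : H a = 0 := intervalIntegral.integral_same
  have hHb : H b = 0 := by simpa using hweak (fun _ => 1) contDiff_const
  set g : ℝ → ℝ := fun r => m r - H r
  have hg : Continuous g := hm.sub hH
  set φ : ℝ → ℝ := fun r => ∫ s in a..r, g s
  have hasDeriv_φ (r : ℝ) : HasDerivAt φ (g r) r := (hg.integral_hasStrictDerivAt a r).hasDerivAt
  have deriv_φ : deriv φ = g := funext fun r => (hasDeriv_φ r).deriv
  have hφ : ContDiff ℝ 1 φ :=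
    contDiff_one_iff_deriv.2 ⟨fun r => (hasDeriv_φ r).differentiableAt, deriv_φ ▸ hg⟩
  have hint {p q : ℝ → ℝ} (hp : Continuous p) (hq : Continuous q) :
      IntervalIntegrable (fun r => p r * q r) volume a b := (hp.mul hq).intervalIntegrable _ _
  have by_parts : ∫ r in a..b, φ r * h r = -∫ r in a..b, g r * H r := by
    rw [intervalIntegral.integral_mul_deriv_eq_deriv_mul (fun r _ => hasDeriv_φ r)
      (fun r _ => hasDeriv_H r) (hg.intervalIntegrable _ _) (hh.intervalIntegrable _ _), hHa, hHb]
    ring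
  have hsq : ∫ r in a..b, g r ^ 2 = 0 := by
    calc ∫ r in a..b, g r ^ 2 = ∫ r in a..b, (g r * m r - g r * H r) :=
          intervalIntegral.integral_congr fun r _ => by simp only [g]; ring
      _ = ∫ r in a..b, (φ r * h r + deriv φ r * m r) := by
          rw [deriv_φ, intervalIntegral.integral_sub (hint hg hm) (hint hg hH),
            intervalIntegral.integral_add (hint hφ.continuous hh) (hint hg hm), by_parts]
          ring
      _ = 0 := hweak φ hφ
  exact (sub_eq_zero.1 (eqOn_zero_of_integral_sq_eq_zero hg hab hsq hr)).symm

end WeakDerivative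

section PolarCoordinates

variable {E F : Type*} [NormedAddCommGroup E] [NormedSpace ℝ E] [FiniteDimensional ℝ E]
  [MeasurableSpace E] [BorelSpace E] (μ : Measure E) [μ.IsAddHaarMeasure]
  [NormedAddCommGroup F] {f : E → F}

local notation "dim" => Module.finrank ℝ

theorem integrable_comp_smul_sphere (hf : Integrable f μ) :
    Integrable (fun q : Metric.sphere (0 : E) 1 × Ioi (0 : ℝ) => f ((q.2 : ℝ) • (q.1 : E)))
      (μ.toSphere.prod (.volumeIoiPow (dim E - 1))) := by
  rw [← μ.measurePreserving_homeomorphUnitSphereProd.integrable_comp_emb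
    (Homeomorph.measurableEmbedding _)]
  have hcomp : (fun q : Metric.sphere (0 : E) 1 × Ioi (0 : ℝ) => f ((q.2 : ℝ) • (q.1 : E))) ∘
      homeomorphUnitSphereProd E = f ∘ Subtype.val := by
    ext x
    simp [smul_smul, norm_ne_zero_iff.2 x.2]
  rw [hcomp, ← integrableOn_iff_comap_subtypeVal (measurableSet_singleton _).compl]
  exact hf.integrableOn

theorem integral_eq_integral_Ioi_integral_sphere [Nontrivial E] [NormedSpace ℝ F]
    (hf : Integrable f μ) :
    ∫ x, f x ∂μ = ∫ r in Ioi (0 : ℝ), r ^ (dim E - 1) •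
      ∫ θ : Metric.sphere (0 : E) 1, f (r • (θ : E)) ∂μ.toSphere :=
  calc ∫ x, f x ∂μ = ∫ x : ({(0 : E)}ᶜ : Set E), f x ∂(μ.comap (↑)) := by
        rw [integral_subtype_comap (measurableSet_singleton _).compl f, restrict_compl_singleton]
    _ = ∫ q, f ((q.2 : ℝ) • (q.1 : E)) ∂(μ.toSphere.prod (.volumeIoiPow (dim E - 1))) := by
        rw [← μ.measurePreserving_homeomorphUnitSphereProd.integral_comp
          (Homeomorph.measurableEmbedding _)]
        exact integral_congr_ae <| .of_forall fun x => by
          simp [smul_smul, norm_ne_zero_iff.2 x.2]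
    _ = ∫ r : Ioi (0 : ℝ), (∫ θ : Metric.sphere (0 : E) 1, f ((r : ℝ) • (θ : E)) ∂μ.toSphere)
          ∂(.volumeIoiPow (dim E - 1)) :=
        integral_prod_symm _ (integrable_comp_smul_sphere μ hf)
    _ = _ := by
        simp only [Measure.volumeIoiPow, ENNReal.ofReal]
        rw [integral_withDensity_eq_integral_smul
            ((measurable_subtype_coe.pow_const _).real_toNNReal),
          integral_subtype_comap measurableSet_Ioi fun r : ℝ => Real.toNNReal (r ^ (dim E - 1)) •
            ∫ θ : Metric.sphere (0 : E) 1, f (r • (θ : E)) ∂μ.toSphere]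
        refine setIntegral_congr_fun measurableSet_Ioi fun r hr => ?_
        rw [NNReal.smul_def, Real.coe_toNNReal _ (pow_nonneg hr.out.le _)]

end PolarCoordinates

section Minkowski

variable {n : ℕ} {p : Spacetime n} {a b : Spacetime n →L[ℝ] ℝ}

/-- The map raising an index: `sharp a` is the vector metrically dual to the covector `a`, with
components `g^{αβ} a_α`. -/
noncomputable def sharp : (Spacetime n →L[ℝ] ℝ) →L[ℝ] Spacetime n :=
  ∑ α, ∑ β, minkowski n α β • (ContinuousLinearMap.apply ℝ ℝ (frame n α)).smulRight (frame n β)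

theorem sharp_apply (a : Spacetime n →L[ℝ] ℝ) :
    sharp a = ∑ α, ∑ β, (minkowski n α β * a (frame n α)) • frame n β := by
  simp [sharp, smul_smul]

theorem contract_eq_apply_sharp (a b : Spacetime n →L[ℝ] ℝ) : contract a b = b (sharp a) := by
  simp only [contract, sharp_apply, map_sum, map_smul, smul_eq_mul]

theorem sum_minkowski_mul (q : Fin (n + 1) → Fin (n + 1) → ℝ) :
    ∑ α, ∑ β, minkowski n α β * q α β = -q 0 0 + ∑ i : Fin n, q i.succ i.succ := by
  simp [minkowski, Matrix.diagonal_apply, Fin.sum_univ_succ]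

theorem contract_comm (a b : Spacetime n →L[ℝ] ℝ) : contract a b = contract b a := by
  simp only [contract, mul_assoc, sum_minkowski_mul]
  simp only [mul_comm]

theorem contract_smul_left (k : ℝ) (a b : Spacetime n →L[ℝ] ℝ) :
    contract (k • a) b = k * contract a b := by
  simp only [contract_eq_apply_sharp, map_smul, smul_eq_mul]

theorem sharp_eq (a : Spacetime n →L[ℝ] ℝ) :
    sharp a = (-a (1, 0), ∑ i, a (0, EuclideanSpace.single i 1) • EuclideanSpace.single i 1) := by
  ext <;> simp [sharp_apply, minkowski, frame, Matrix.diagonal_apply, Fin.sum_univ_succ,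
    Prod.fst_sum, Prod.snd_sum]

theorem inner_sharp_snd (a : Spacetime n →L[ℝ] ℝ) (v : EuclideanSpace ℝ (Fin n)) :
    inner ℝ (sharp a).2 v = a (0, v) := by
  have hv : ∑ i, v i • EuclideanSpace.single i (1 : ℝ) = v := by
    simpa using (EuclideanSpace.basisFun (Fin n) ℝ).sum_repr v
  calc inner ℝ (sharp a).2 v = ∑ i, v i * a (0, EuclideanSpace.single i 1) := by
        simp [sharp_eq, sum_inner, inner_smul_left, EuclideanSpace.inner_single_left, mul_comm]
    _ = a.comp (.inr ℝ ℝ _) (∑ i, v i • EuclideanSpace.single i 1) := by simp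
    _ = a (0, v) := by rw [hv]; rfl

theorem contract_self (a : Spacetime n →L[ℝ] ℝ) :
    contract a a = ‖(sharp a).2‖ ^ 2 - a (1, 0) ^ 2 := by
  rw [contract_eq_apply_sharp, ← real_inner_self_eq_norm_sq, inner_sharp_snd]
  nth_rw 1 [show sharp a = (-a (1, 0)) • (1, 0) + (0, (sharp a).2) by simp [sharp_eq]]
  rw [map_add, map_smul, smul_eq_mul]
  ring

/-- The Minkowski divergence `g^{αβ} ∂_α η_β` of a covector field. -/
noncomputable def minkowskiDiv (η : Spacetime n → Spacetime n →L[ℝ] ℝ) (p : Spacetime n) : ℝ :=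
  ∑ α, ∑ β, minkowski n α β * fderiv ℝ (fun q => η q (frame n β)) p (frame n α)

theorem waveOp_eq_minkowskiDiv_fderiv (φ : Spacetime n → ℝ) :
    waveOp φ = minkowskiDiv (fderiv ℝ φ) := rfl

variable {η ζ : Spacetime n → Spacetime n →L[ℝ] ℝ} {φ : Spacetime n → ℝ}

theorem minkowskiDiv_eq_of_hasFDerivAt {η' : Spacetime n →L[ℝ] Spacetime n →L[ℝ] ℝ}
    (hη : HasFDerivAt η η' p) :
    minkowskiDiv η p = ∑ α, ∑ β, minkowski n α β * η' (frame n α) (frame n β) := by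
  have (v w : Spacetime n) : fderiv ℝ (fun q => η q v) p w = η' w v := by
    simp [(hη.clm_apply (hasFDerivAt_const v p)).fderiv]
  simp only [minkowskiDiv, this]

theorem minkowskiDiv_congr (h : η =ᶠ[𝓝 p] ζ) : minkowskiDiv η p = minkowskiDiv ζ p := by
  have (v : Spacetime n) : (fun q => η q v) =ᶠ[𝓝 p] fun q => ζ q v :=
    h.fun_comp fun a : Spacetime n →L[ℝ] ℝ => a v
  simp only [minkowskiDiv, (this _).fderiv_eq]

theorem minkowskiDiv_add (hη : DifferentiableAt ℝ η p) (hζ : DifferentiableAt ℝ ζ p) :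
    minkowskiDiv (η + ζ) p = minkowskiDiv η p + minkowskiDiv ζ p := by
  rw [minkowskiDiv_eq_of_hasFDerivAt hη.hasFDerivAt, minkowskiDiv_eq_of_hasFDerivAt hζ.hasFDerivAt,
    minkowskiDiv_eq_of_hasFDerivAt (hη.hasFDerivAt.add hζ.hasFDerivAt)]
  simp only [add_apply, mul_add, Finset.sum_add_distrib]

theorem minkowskiDiv_smul (hφ : DifferentiableAt ℝ φ p) (hη : DifferentiableAt ℝ η p) :
    minkowskiDiv (φ • η) p =
      φ p * minkowskiDiv η p + contract (fderiv ℝ φ p) (η p) := by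
  rw [minkowskiDiv_eq_of_hasFDerivAt hη.hasFDerivAt,
    minkowskiDiv_eq_of_hasFDerivAt (hφ.hasFDerivAt.smul hη.hasFDerivAt)]
  simp only [contract, Finset.mul_sum, ← Finset.sum_add_distrib]
  refine Finset.sum_congr rfl fun α _ => Finset.sum_congr rfl fun β _ => ?_
  simp only [add_apply, smul_apply, ContinuousLinearMap.smulRight_apply, smul_eq_mul]
  ring

theorem continuous_minkowskiDiv (hη : ContDiff ℝ 1 η) : Continuous (minkowskiDiv η) :=
  continuous_finsetSum _ fun _ _ => continuous_finsetSum _ fun _ _ =>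
    ((hη.clm_apply contDiff_const).continuous_fderiv_apply one_ne_zero |>.comp
      (continuous_id.prodMk continuous_const)).const_mul _

theorem tsupport_minkowskiDiv_subset (η : Spacetime n → Spacetime n →L[ℝ] ℝ) :
    tsupport (minkowskiDiv η) ⊆ tsupport η := by
  refine closure_minimal (fun p hp => ?_) (isClosed_tsupport η)
  by_contra h
  refine hp ?_
  rw [minkowskiDiv_congr (notMem_tsupport_iff_eventuallyEq.1 h)]
  simp [minkowskiDiv]

end Minkowski

section ZeroIntegral

theorem integral_fderiv_apply_eq_zero {E : Type*} [NormedAddCommGroup E] [NormedSpace ℝ E]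
    [FiniteDimensional ℝ E] [MeasurableSpace E] [BorelSpace E] {μ : Measure E}
    [μ.IsAddHaarMeasure] {f : E → ℝ} (hf : ContDiff ℝ 1 f) (hc : HasCompactSupport f) (v : E) :
    ∫ x, fderiv ℝ f x v ∂μ = 0 := by
  have hint : Integrable (fun x => fderiv ℝ f x v) μ :=
    ((hf.continuous_fderiv one_ne_zero).clm_apply continuous_const).integrable_of_hasCompactSupport
      ((hc.fderiv ℝ).comp_left (g := fun L : E →L[ℝ] ℝ => L v) rfl)
  simpa using integral_mul_fderiv_eq_neg_fderiv_mul_of_integrable (f := fun _ => (1 : ℝ)) (v := v)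
    (by simp) (by simpa using hint)
    (by simpa using hf.continuous.integrable_of_hasCompactSupport hc)
    (fun x _ => differentiableAt_const _) (fun x _ => hf.differentiable one_ne_zero x)

theorem integral_minkowskiDiv_eq_zero {n : ℕ} {η : Spacetime n → Spacetime n →L[ℝ] ℝ}
    (hη : ContDiff ℝ 1 η) (hc : HasCompactSupport η) : ∫ p, minkowskiDiv η p = 0 := by
  have : (volume : Measure (Spacetime n)).IsAddHaarMeasure :=
    Measure.prod.instIsAddHaarMeasure volume volume
  have hηv (v : Spacetime n) : ContDiff ℝ 1 fun q => η q v := hη.clm_apply contDiff_const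
  have hcv (v : Spacetime n) : HasCompactSupport fun q => η q v :=
    hc.comp_left (g := fun a : Spacetime n →L[ℝ] ℝ => a v) rfl
  have hint (v w : Spacetime n) : Integrable fun p => fderiv ℝ (fun q => η q v) p w :=
    (((hηv v).continuous_fderiv one_ne_zero).clm_apply
      continuous_const).integrable_of_hasCompactSupport
      (((hcv v).fderiv ℝ).comp_left (g := fun L : Spacetime n →L[ℝ] ℝ => L w) rfl)
  simp only [minkowskiDiv, sum_minkowski_mul]
  rw [integral_add (hint _ _).fun_neg (integrable_finsetSum _ fun i _ => hint _ _), integral_neg,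
    integral_finsetSum _ fun i _ => hint _ _]
  simp only [integral_fderiv_apply_eq_zero (hηv _) (hcv _), neg_zero,
    Finset.sum_const_zero, add_zero]

end ZeroIntegral

section LateralIntegral

variable {n : ℕ} {T r : ℝ} {F G : Spacetime n → ℝ}

local notation "𝕊" => Metric.sphere (0 : EuclideanSpace ℝ (Fin n)) 1

theorem norm_smul_sphere {E : Type*} [NormedAddCommGroup E] [NormedSpace ℝ E] (hr : 0 ≤ r)
    (θ : Metric.sphere (0 : E) 1) : ‖r • (θ : E)‖ = r := by
  rw [norm_smul, norm_eq_of_mem_sphere, mul_one, Real.norm_of_nonneg hr]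

theorem integrable_comp_smul_sphere_prod (hF : Continuous F) (T r : ℝ) :
    Integrable (fun q : ℝ × 𝕊 => F (q.1, r • (q.2 : EuclideanSpace ℝ (Fin n))))
      ((volume.restrict (Ioo (-T) T)).prod volume.toSphere) := by
  rw [restrict_Ioo_eq_restrict_Icc, ← Measure.restrict_univ (μ := Measure.toSphere _),
    Measure.prod_restrict]
  exact (by fun_prop : Continuous _).continuousOn.integrableOn_compact
    (isCompact_Icc.prod isCompact_univ)

theorem lateralIntegral_eq_integral_prod (hF : Continuous F) (T r : ℝ) :
    lateralIntegral T r F = r ^ (n - 1) *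
      ∫ q : ℝ × 𝕊, F (q.1, r • (q.2 : EuclideanSpace ℝ (Fin n)))
        ∂((volume.restrict (Ioo (-T) T)).prod volume.toSphere) := by
  rw [lateralIntegral, integral_const_mul,
    integral_prod _ (integrable_comp_smul_sphere_prod hF T r)]

theorem continuous_lateralIntegral (hF : Continuous F) (T : ℝ) :
    Continuous fun r => lateralIntegral T r F := by
  simp only [lateralIntegral_eq_integral_prod hF, restrict_Ioo_eq_restrict_Icc]
  rw [← Measure.restrict_univ (μ := Measure.toSphere _), Measure.prod_restrict]
  exact (continuous_pow _).mul <| continuous_parametric_integral_of_continuous (by fun_prop)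
    (isCompact_Icc.prod isCompact_univ)

theorem lateralIntegral_congr (hr : 0 ≤ r)
    (h : ∀ p : Spacetime n, p.1 ∈ Ioo (-T) T → ‖p.2‖ = r → F p = G p) :
    lateralIntegral T r F = lateralIntegral T r G :=
  setIntegral_congr_fun measurableSet_Ioo fun t ht => by
    simp only [h (t, r • (_ : EuclideanSpace ℝ (Fin n))) ht (norm_smul_sphere hr _)]

theorem lateralIntegral_const_mul (a : ℝ) (F : Spacetime n → ℝ) :
    lateralIntegral T r (fun p => a * F p) = a * lateralIntegral T r F := by
  simp only [lateralIntegral, integral_const_mul, mul_left_comm _ a]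

theorem lateralIntegral_add (hF : Continuous F) (hG : Continuous G) :
    lateralIntegral T r (fun p => F p + G p) = lateralIntegral T r F + lateralIntegral T r G := by
  rw [lateralIntegral_eq_integral_prod (hF.fun_add hG), lateralIntegral_eq_integral_prod hF,
    lateralIntegral_eq_integral_prod hG, ← mul_add,
    ← integral_add (integrable_comp_smul_sphere_prod hF T r)
      (integrable_comp_smul_sphere_prod hG T r)]

theorem setIntegral_prod_norm_preimage_eq_integral_lateralIntegral (hn : 1 ≤ n)
    (hF : Continuous F) (hc : HasCompactSupport F) {s : Set ℝ} (hs : MeasurableSet s)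
    (hs0 : s ⊆ Ioi 0) (T : ℝ) :
    ∫ p in {p : Spacetime n | p.1 ∈ Ioo (-T) T ∧ ‖p.2‖ ∈ s}, F p =
      ∫ r in s, lateralIntegral T r F := by
  have : Nonempty (Fin n) := ⟨⟨0, hn⟩⟩
  set S : Set (EuclideanSpace ℝ (Fin n)) := norm ⁻¹' s
  have hS : MeasurableSet S := measurable_norm hs
  set K : EuclideanSpace ℝ (Fin n) → ℝ := fun x => ∫ t in Ioo (-T) T, F (t, x)
  have hFint (S : Set (EuclideanSpace ℝ (Fin n))) :
      Integrable F ((volume.restrict (Ioo (-T) T)).prod (volume.restrict S)) := by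
    rw [Measure.prod_restrict]
    exact (hF.integrable_of_hasCompactSupport hc (μ := volume)).restrict
  have hK : Integrable (S.indicator K) :=
    (integrable_indicator_iff hS).2 (hFint S).integral_prod_right
  calc ∫ p in Ioo (-T) T ×ˢ S, F p
      = ∫ x, S.indicator K x := by
        rw [Measure.volume_eq_prod, ← Measure.prod_restrict, integral_prod_symm _ (hFint S),
          integral_indicator hS]
    _ = ∫ r in Ioi 0,
          s.indicator (fun r => r ^ (n - 1) * ∫ θ : 𝕊, K (r • θ) ∂volume.toSphere) r := by
        rw [integral_eq_integral_Ioi_integral_sphere _ hK, finrank_euclideanSpace_fin]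
        refine setIntegral_congr_fun measurableSet_Ioi fun r (hr : 0 < r) => ?_
        by_cases hrs : r ∈ s <;> simp [S, indicator, norm_smul, abs_of_pos hr, hrs]
    _ = ∫ r in s, r ^ (n - 1) * ∫ θ : 𝕊, K (r • θ) ∂volume.toSphere := by
        rw [setIntegral_indicator hs, inter_eq_right.2 hs0]
    _ = ∫ r in s, lateralIntegral T r F := by
        simp only [lateralIntegral_eq_integral_prod hF,
          integral_prod_symm _ (integrable_comp_smul_sphere_prod hF T _), K]

end LateralIntegral

section Cutoff

theorem exists_contDiff_support_subset_Icc_eq_one {ε : ℝ} (hε : 0 < ε) (hε' : ε < 1 / 2) :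
    ∃ χ : ℝ → ℝ, ContDiff ℝ ∞ χ ∧ Function.support χ ⊆ Icc (ε / 2) (1 - ε / 2) ∧
      ∀ r ∈ Icc ε (1 - ε), χ r = 1 := by
  let χ : ContDiffBump (1 / 2 : ℝ) := ⟨1 / 2 - ε, 1 / 2 - ε / 2, by linarith, by linarith⟩
  have hball : Icc ε (1 - ε) = Metric.closedBall (1 / 2) (1 / 2 - ε) := by
    rw [Real.closedBall_eq_Icc]
    ring_nf
  refine ⟨χ, χ.contDiff, ?_, fun r hr => χ.one_of_mem_closedBall (hball ▸ hr)⟩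
  rw [χ.support_eq, Real.ball_eq_Ioo]
  refine Ioo_subset_Icc_self.trans (Icc_subset_Icc ?_ ?_) <;> simp only [χ] <;> linarith

theorem contDiff_of_tsupport {𝕜 E F : Type*} [NontriviallyNormedField 𝕜] [NormedAddCommGroup E]
    [NormedSpace 𝕜 E] [NormedAddCommGroup F] [NormedSpace 𝕜 F] {k : WithTop ℕ∞} {f : E → F}
    (hf : ∀ x ∈ tsupport f, ContDiffAt 𝕜 k f x) : ContDiff 𝕜 k f :=
  contDiff_iff_contDiffAt.2 fun x => (em _).elim (hf x) fun hx =>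
    contDiffAt_const.congr_of_eventuallyEq (notMem_tsupport_iff_eventuallyEq.1 hx)

end Cutoff

/-- The cylinder `𝒞` with its axis `{x = 0}`, where `r = |x|` is not smooth, removed. -/
def puncturedCylinder (n : ℕ) (T : ℝ) : Set (Spacetime n) :=
  {p | p.1 ∈ Ioo (-T) T ∧ ‖p.2‖ ∈ Ioo 0 1}

/-- Fields on the punctured cylinder of class `C^k` that vanish for `|t| > T - δ`. No control is
imposed at the axis or at `{r = 1}`: the integrals only see `ε ≤ r ≤ 1 - ε`. -/
structure Admissible {n : ℕ} {V : Type*} [NormedAddCommGroup V] [NormedSpace ℝ V] (T δ : ℝ)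
    (k : WithTop ℕ∞) (F : Spacetime n → V) : Prop where
  contDiffOn : ContDiffOn ℝ k F (puncturedCylinder n T)
  eq_zero : ∀ p ∈ puncturedCylinder n T, T - δ < |p.1| → F p = 0

section Admissible

variable {n : ℕ} {T δ ε : ℝ} {k : WithTop ℕ∞} {V : Type*} [NormedAddCommGroup V] [NormedSpace ℝ V]
  {F : Spacetime n → V} {p : Spacetime n}

theorem isOpen_puncturedCylinder (n : ℕ) (T : ℝ) : IsOpen (puncturedCylinder n T) :=
  (isOpen_Ioo.preimage continuous_fst).inter (isOpen_Ioo.preimage continuous_snd.norm)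

theorem isOpen_cylinderEps (n : ℕ) (T ε : ℝ) : IsOpen (cylinderEps n T ε) :=
  (isOpen_Ioo.preimage continuous_fst).inter (isOpen_Ioo.preimage continuous_snd.norm)

theorem snd_ne_zero_of_mem_puncturedCylinder (hp : p ∈ puncturedCylinder n T) : p.2 ≠ 0 :=
  norm_pos_iff.1 hp.2.1

theorem cylinderEps_subset_puncturedCylinder (hε : 0 < ε) :
    cylinderEps n T ε ⊆ puncturedCylinder n T := fun _ hp =>
  ⟨hp.1, hε.trans hp.2.1, hp.2.2.trans (by linarith)⟩

theorem isCompact_Icc_prod_norm_preimage_Icc (a b c d : ℝ) :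
    IsCompact (Icc a b ×ˢ (norm ⁻¹' Icc c d : Set (EuclideanSpace ℝ (Fin n)))) :=
  isCompact_Icc.prod <| (isCompact_closedBall 0 d).of_isClosed_subset
    (isClosed_Icc.preimage continuous_norm) fun _ hx => mem_closedBall_zero_iff.2 hx.2

theorem Admissible.contDiffAt (hF : Admissible T δ k F) (hp : p ∈ puncturedCylinder n T) :
    ContDiffAt ℝ k F p :=
  hF.contDiffOn.contDiffAt ((isOpen_puncturedCylinder n T).mem_nhds hp)

theorem Admissible.exists_contDiff_eqOn (hF : Admissible T δ k F) (hk : k ≤ ∞) (hδ : 0 < δ)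
    (hε : 0 < ε) (hε' : ε < 1 / 2) :
    ∃ G : Spacetime n → V, ContDiff ℝ k G ∧ HasCompactSupport G ∧
      tsupport G ⊆ puncturedCylinder n T ∧
      ∀ p : Spacetime n, p.1 ∈ Ioo (-T) T → ‖p.2‖ ∈ Icc ε (1 - ε) → G p = F p := by
  obtain ⟨χ, hχ, hχ_supp, hχ_one⟩ := exists_contDiff_support_subset_Icc_eq_one hε hε'
  set C := puncturedCylinder n T
  set f : Spacetime n → V := fun p => χ ‖p.2‖ • F p
  set K : Set (Spacetime n) := Icc (-(T - δ)) (T - δ) ×ˢ (norm ⁻¹' Icc (ε / 2) (1 - ε / 2))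
  have hK : IsCompact K := isCompact_Icc_prod_norm_preimage_Icc _ _ _ _
  have hKC : K ⊆ C := fun p hp =>
    ⟨⟨by linarith [hp.1.1], by linarith [hp.1.2]⟩, by linarith [hp.2.1], by linarith [hp.2.2]⟩
  have hf : ContDiffOn ℝ k f C := fun p hp =>
    ((((hχ.contDiffAt.of_le hk).comp p (contDiffAt_snd.norm ℝ
      (snd_ne_zero_of_mem_puncturedCylinder hp))).smul (hF.contDiffAt hp))).contDiffWithinAt
  have hsupp : Function.support (C.indicator f) ⊆ K := fun p hp => by
    have hpC : p ∈ C := mem_of_indicator_ne_zero hp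
    rw [Function.mem_support, indicator_of_mem hpC, smul_ne_zero_iff] at hp
    exact ⟨abs_le.1 (not_lt.1 fun ht => hp.2 (hF.eq_zero p hpC ht)), hχ_supp hp.1⟩
  have hts : tsupport (C.indicator f) ⊆ C := (closure_minimal hsupp hK.isClosed).trans hKC
  refine ⟨C.indicator f, contDiff_of_tsupport fun p hp => ?_,
    .of_support_subset_isCompact hK hsupp, hts, fun p ht hr => ?_⟩
  · have hC : C ∈ 𝓝 p := (isOpen_puncturedCylinder n T).mem_nhds (hts hp)
    exact (hf.contDiffAt hC).congr_of_eventuallyEq (eqOn_indicator.eventuallyEq_of_mem hC)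
  · have hpC : p ∈ C := ⟨ht, hε.trans_le hr.1, by linarith [hr.2]⟩
    simp [f, indicator_of_mem hpC, hχ_one _ hr]

theorem Admissible.integrableOn_cylinderEps (hF : Admissible T δ 0 F) (hδ : 0 < δ)
    (hε : 0 < ε) (hε' : ε < 1 / 2) : IntegrableOn F (cylinderEps n T ε) := by
  obtain ⟨G, hG, hGc, -, hGF⟩ := hF.exists_contDiff_eqOn (by simp) hδ hε hε'
  exact (hG.continuous.integrable_of_hasCompactSupport hGc).integrableOn.congr_fun
    (fun p hp => hGF p hp.1 (Ioo_subset_Icc_self hp.2)) (isOpen_cylinderEps n T ε).measurableSet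

theorem Admissible.lateralIntegral_add {F G : Spacetime n → ℝ} (hF : Admissible T δ 0 F)
    (hG : Admissible T δ 0 G) (hδ : 0 < δ) (hε : 0 < ε) (hε' : ε < 1 / 2) {r : ℝ}
    (hr : r ∈ Icc ε (1 - ε)) :
    lateralIntegral T r (fun p => F p + G p) = lateralIntegral T r F + lateralIntegral T r G := by
  obtain ⟨F', hF', -, -, hFF'⟩ := hF.exists_contDiff_eqOn (by simp) hδ hε hε'
  obtain ⟨G', hG', -, -, hGG'⟩ := hG.exists_contDiff_eqOn (by simp) hδ hε hε'
  have hr0 : 0 ≤ r := hε.le.trans hr.1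
  rw [← lateralIntegral_congr hr0 fun p ht hp => hFF' p ht (hp ▸ hr),
    ← lateralIntegral_congr hr0 fun p ht hp => hGG' p ht (hp ▸ hr),
    ← TwistedWave.lateralIntegral_add hF'.continuous hG'.continuous]
  exact (lateralIntegral_congr hr0 fun p ht hp => by
    rw [hFF' p ht (hp ▸ hr), hGG' p ht (hp ▸ hr)]).symm

end Admissible

section RadialCovector

variable {n : ℕ} {p : Spacetime n}

/-- The covector field `dr`, which is metrically dual to `∂_r`. -/
noncomputable def radialCovector (p : Spacetime n) : Spacetime n →L[ℝ] ℝ :=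
  (innerSL ℝ (radial p).2).comp (.snd ℝ ℝ _)

theorem radialCovector_apply (p v : Spacetime n) :
    radialCovector p v = inner ℝ (radial p).2 v.2 := rfl

theorem hasFDerivAt_norm_snd (hp : p.2 ≠ 0) :
    HasFDerivAt (fun q : Spacetime n => ‖q.2‖) (radialCovector p) p := by
  have h := (hasFDerivAt_snd (𝕜 := ℝ) (p := p)).norm_sq.sqrt (by positivity)
  simp only [Real.sqrt_sq (norm_nonneg _)] at h
  refine h.congr_fderiv ?_
  ext v
  · simp [radialCovector]
  · simp only [one_div, mul_inv_rev, ContinuousLinearMap.smul_comp, smul_apply,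
      ContinuousLinearMap.comp_apply, ContinuousLinearMap.inr_apply, ContinuousLinearMap.coe_snd',
      coe_innerSL_apply, nsmul_eq_mul, Nat.cast_ofNat, smul_eq_mul, radialCovector, radial,
      map_smul]
    ring

theorem hasFDerivAt_comp_norm_snd {φ : ℝ → ℝ} {φ' : ℝ} (hφ : HasDerivAt φ φ' ‖p.2‖)
    (hp : p.2 ≠ 0) :
    HasFDerivAt (fun q : Spacetime n => φ ‖q.2‖) (φ' • radialCovector p) p :=
  hφ.comp_hasFDerivAt p (hasFDerivAt_norm_snd hp)

theorem sharp_radialCovector (p : Spacetime n) : sharp (radialCovector p) = radial p := by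
  refine Prod.ext (by simp [sharp_eq, radialCovector_apply, radial]) ?_
  exact ext_inner_right ℝ fun v => inner_sharp_snd _ v

theorem contract_radialCovector (a : Spacetime n →L[ℝ] ℝ) :
    contract (radialCovector p) a = a (radial p) := by
  rw [contract_eq_apply_sharp, sharp_radialCovector]

theorem radialCovector_sharp (a : Spacetime n →L[ℝ] ℝ) :
    radialCovector p (sharp a) = a (radial p) := by
  rw [← contract_eq_apply_sharp, contract_comm, contract_radialCovector]

theorem radialCovector_radial (hp : p.2 ≠ 0) : radialCovector p (radial p) = 1 := by
  rw [radialCovector_apply, real_inner_self_eq_norm_sq, radial, norm_smul, norm_inv, norm_norm,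
    inv_mul_cancel₀ (norm_ne_zero_iff.2 hp), one_pow]

theorem contDiffAt_radialCovector {k : WithTop ℕ∞} (hp : p.2 ≠ 0) :
    ContDiffAt ℝ k (radialCovector (n := n)) p := by
  have hr : ContDiffAt ℝ k (fun q : Spacetime n => (radial q).2) p :=
    ((contDiffAt_snd.norm ℝ hp).inv (norm_ne_zero_iff.2 hp)).smul contDiffAt_snd
  exact ((innerSL ℝ).contDiff.contDiffAt.comp p hr).clm_comp contDiffAt_const

theorem fderiv_radialCovector (hp : p.2 ≠ 0) (v w : Spacetime n) :
    fderiv ℝ radialCovector p v w =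
      (inner ℝ v.2 w.2 - radialCovector p v * radialCovector p w) / ‖p.2‖ := by
  have hr : ‖p.2‖ ≠ 0 := norm_ne_zero_iff.2 hp
  have hdr : DifferentiableAt ℝ (radialCovector (n := n)) p :=
    (contDiffAt_radialCovector hp).differentiableAt one_ne_zero
  have h := (hasFDerivAt_comp_norm_snd (hasDerivAt_inv hr) hp).fun_mul
    ((innerSL ℝ w.2).comp (.snd ℝ ℝ _)).hasFDerivAt
  have heq : (fun q => radialCovector q w) =
      fun q : Spacetime n => ‖q.2‖⁻¹ * (innerSL ℝ w.2).comp (.snd ℝ ℝ _) q := by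
    funext q
    simp [radialCovector, radial, real_inner_comm]
  calc fderiv ℝ radialCovector p v w = fderiv ℝ (fun q => radialCovector q w) p v := by
        simp [(hdr.hasFDerivAt.clm_apply (hasFDerivAt_const w p)).fderiv]
    _ = _ := by
        rw [heq, h.fderiv]
        simp only [ContinuousLinearMap.comp_apply, ContinuousLinearMap.coe_snd', coe_innerSL_apply,
          real_inner_comm, radialCovector, radial, map_smul, ContinuousLinearMap.smul_comp,
          add_apply, smul_apply, smul_eq_mul, neg_mul, mul_neg]
        field_simp
        ring

end RadialCovector

section DivergenceTheorem

variable {n : ℕ} {T δ ε : ℝ} {η : Spacetime n → Spacetime n →L[ℝ] ℝ} {p : Spacetime n}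

theorem continuousAt_radial (hp : p.2 ≠ 0) : ContinuousAt radial p :=
  continuousAt_const.prodMk <| (continuousAt_snd.norm.inv₀ (norm_ne_zero_iff.2 hp)).smul
    continuousAt_snd

theorem minkowskiDiv_comp_norm_smul {φ : ℝ → ℝ} (hφ : DifferentiableAt ℝ φ ‖p.2‖)
    (hη : DifferentiableAt ℝ η p) (hp : p.2 ≠ 0) :
    minkowskiDiv ((fun q : Spacetime n => φ ‖q.2‖) • η) p =
      φ ‖p.2‖ * minkowskiDiv η p + deriv φ ‖p.2‖ * η p (radial p) := by
  have h := hasFDerivAt_comp_norm_snd hφ.hasDerivAt hp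
  rw [minkowskiDiv_smul h.differentiableAt hη, h.fderiv, contract_smul_left,
    contract_radialCovector]

theorem continuous_apply_radial (hη : Continuous η) (hsupp : ∀ p ∈ tsupport η, p.2 ≠ 0) :
    Continuous fun p => η p (radial p) := by
  have hts : (tsupport fun p => η p (radial p)) ⊆ tsupport η :=
    closure_mono fun p hp h => hp (by simp [h])
  exact continuous_of_tsupport fun p hp =>
    hη.continuousAt.clm_apply (continuousAt_radial (hsupp p (hts hp)))

theorem integral_comp_norm_mul_minkowskiDiv_add_deriv_mul_eq_zero (hη : ContDiff ℝ 1 η)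
    (hc : HasCompactSupport η) (hsupp : ∀ p ∈ tsupport η, p.2 ≠ 0) {φ : ℝ → ℝ}
    (hφ : ContDiff ℝ 1 φ) :
    ∫ p, (φ ‖p.2‖ * minkowskiDiv η p + deriv φ ‖p.2‖ * η p (radial p)) = 0 := by
  set X : Spacetime n → Spacetime n →L[ℝ] ℝ := (fun p : Spacetime n => φ ‖p.2‖) • η
  have hXη : tsupport X ⊆ tsupport η := closure_mono fun p hp h => hp (by simp [X, h])
  have hX : ContDiff ℝ 1 X := contDiff_of_tsupport fun p hp =>
    (hφ.contDiffAt.comp p (contDiffAt_snd.norm ℝ (hsupp p (hXη hp)))).smul hη.contDiffAt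
  have hdiv (p : Spacetime n) : minkowskiDiv X p =
      φ ‖p.2‖ * minkowskiDiv η p + deriv φ ‖p.2‖ * η p (radial p) := by
    by_cases hp : p ∈ tsupport η
    · exact minkowskiDiv_comp_norm_smul (hφ.differentiable one_ne_zero _)
        (hη.differentiable one_ne_zero p) (hsupp p hp)
    · rw [image_eq_zero_of_notMem_tsupport fun h => hp (hXη (tsupport_minkowskiDiv_subset X h)),
        image_eq_zero_of_notMem_tsupport fun h => hp (tsupport_minkowskiDiv_subset η h),
        image_eq_zero_of_notMem_tsupport hp]
      simp
  have hXc : HasCompactSupport X := hc.mono' (subset_closure.trans hXη)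
  simp_rw [← hdiv]
  exact integral_minkowskiDiv_eq_zero hX hXc

theorem intervalIntegral_mul_lateralIntegral_minkowskiDiv_add_deriv_mul_eq_zero (hn : 1 ≤ n)
    (hη : ContDiff ℝ 1 η) (hc : HasCompactSupport η) (hsupp : tsupport η ⊆ puncturedCylinder n T)
    {φ : ℝ → ℝ} (hφ : ContDiff ℝ 1 φ) :
    ∫ r in 0..1, (φ r * lateralIntegral T r (minkowskiDiv η) +
      deriv φ r * lateralIntegral T r fun p => η p (radial p)) = 0 := by
  have hne : ∀ p ∈ tsupport η, p.2 ≠ 0 := fun p hp =>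
    snd_ne_zero_of_mem_puncturedCylinder (hsupp hp)
  have hφc : Continuous fun p : Spacetime n => φ ‖p.2‖ := hφ.continuous.comp continuous_snd.norm
  have hφc' : Continuous fun p : Spacetime n => deriv φ ‖p.2‖ :=
    (hφ.continuous_deriv le_rfl).comp continuous_snd.norm
  have hA : Continuous fun p => φ ‖p.2‖ * minkowskiDiv η p :=
    hφc.mul (continuous_minkowskiDiv hη)
  have hB : Continuous fun p => deriv φ ‖p.2‖ * η p (radial p) :=
    hφc'.mul (continuous_apply_radial hη.continuous hne)
  set F : Spacetime n → ℝ := fun p => φ ‖p.2‖ * minkowskiDiv η p + deriv φ ‖p.2‖ * η p (radial p)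
  have hF0 : ∀ p ∉ tsupport η, F p = 0 := fun p hp => by
    simp [F, image_eq_zero_of_notMem_tsupport hp,
      image_eq_zero_of_notMem_tsupport fun h => hp (tsupport_minkowskiDiv_subset η h)]
  have hFc : HasCompactSupport F := .intro hc.isCompact hF0
  calc ∫ r in 0..1, (φ r * lateralIntegral T r (minkowskiDiv η) +
        deriv φ r * lateralIntegral T r fun p => η p (radial p))
      = ∫ r in Ioo 0 1, lateralIntegral T r F := by
        rw [intervalIntegral.integral_of_le zero_le_one, integral_Ioc_eq_integral_Ioo]
        refine setIntegral_congr_fun measurableSet_Ioo fun r hr => ?_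
        simp only [F, lateralIntegral_add hA hB, ← lateralIntegral_const_mul]
        congr 1 <;> exact lateralIntegral_congr hr.1.le fun p _ hp => by rw [hp]
    _ = ∫ p in puncturedCylinder n T, F p :=
        (setIntegral_prod_norm_preimage_eq_integral_lateralIntegral hn (hA.add hB) hFc
          measurableSet_Ioo (fun _ hr => hr.1) T).symm
    _ = ∫ p, F p := setIntegral_eq_integral_of_forall_compl_eq_zero fun p hp =>
        hF0 p fun h => hp (hsupp h)
    _ = 0 := integral_comp_norm_mul_minkowskiDiv_add_deriv_mul_eq_zero hη hc hne hφ

/-- The integral over `Γ_ε` of the outward normal component of a covector field. -/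
noncomputable def normalFlux (T ε : ℝ) (η : Spacetime n → Spacetime n →L[ℝ] ℝ) : ℝ :=
  gammaIntegral T ε fun p => η p (outwardNormal ε p)

theorem normalFlux_eq (hε : 0 < ε) (hε' : ε < 1 / 2)
    (η : Spacetime n → Spacetime n →L[ℝ] ℝ) :
    normalFlux T ε η = lateralIntegral T (1 - ε) (fun p => η p (radial p)) -
      lateralIntegral T ε fun p => η p (radial p) := by
  have hin : lateralIntegral T ε (fun p => η p (outwardNormal ε p)) =
      -lateralIntegral T ε fun p => η p (radial p) := by
    rw [← neg_one_mul, ← lateralIntegral_const_mul]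
    exact lateralIntegral_congr hε.le fun p _ hp => by simp [outwardNormal, hp]
  have hout : lateralIntegral T (1 - ε) (fun p => η p (outwardNormal ε p)) =
      lateralIntegral T (1 - ε) fun p => η p (radial p) :=
    lateralIntegral_congr (by linarith) fun p _ hp => by
      rw [outwardNormal, if_neg (by rw [hp]; linarith)]
  rw [normalFlux, gammaIntegral, hin, hout, neg_add_eq_sub]

theorem setIntegral_cylinderEps_minkowskiDiv_of_hasCompactSupport (hn : 1 ≤ n)
    (hη : ContDiff ℝ 1 η) (hc : HasCompactSupport η) (hsupp : tsupport η ⊆ puncturedCylinder n T)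
    (hε : 0 < ε) (hε' : ε < 1 / 2) :
    ∫ p in cylinderEps n T ε, minkowskiDiv η p = normalFlux T ε η := by
  have hdiv := continuous_minkowskiDiv hη
  have hlat := continuous_lateralIntegral hdiv T
  have hflux := continuous_lateralIntegral (continuous_apply_radial hη.continuous fun p hp =>
    snd_ne_zero_of_mem_puncturedCylinder (hsupp hp)) T
  have hprim (r : ℝ) (hr : r ∈ Icc 0 1) : ∫ s in 0..r, lateralIntegral T s (minkowskiDiv η) =
      lateralIntegral T r fun p => η p (radial p) :=
    integral_eq_of_forall_integral_mul_add_deriv_mul_eq_zero hlat hflux zero_lt_one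
      (fun φ hφ => intervalIntegral_mul_lateralIntegral_minkowskiDiv_add_deriv_mul_eq_zero
        hn hη hc hsupp hφ) hr
  calc ∫ p in cylinderEps n T ε, minkowskiDiv η p
      = ∫ r in ε..1 - ε, lateralIntegral T r (minkowskiDiv η) := by
        rw [intervalIntegral.integral_of_le (by linarith), integral_Ioc_eq_integral_Ioo]
        exact setIntegral_prod_norm_preimage_eq_integral_lateralIntegral hn hdiv
          (hc.mono' (subset_closure.trans (tsupport_minkowskiDiv_subset η))) measurableSet_Ioo
          (fun r hr => hε.trans hr.1) T
    _ = normalFlux T ε η := by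
        rw [normalFlux_eq hε hε', ← hprim _ ⟨by linarith, by linarith⟩,
          ← hprim _ ⟨hε.le, by linarith⟩, intervalIntegral.integral_interval_sub_left
          (hlat.intervalIntegrable _ _) (hlat.intervalIntegrable _ _)]

theorem setIntegral_cylinderEps_minkowskiDiv (hn : 1 ≤ n) (hη : Admissible T δ 1 η) (hδ : 0 < δ)
    (hε : 0 < ε) (hε' : ε < 1 / 2) :
    ∫ p in cylinderEps n T ε, minkowskiDiv η p = normalFlux T ε η := by
  obtain ⟨X, hX, hXc, hX_supp, hXη⟩ :=
    hη.exists_contDiff_eqOn (by exact_mod_cast le_top) hδ hε hε'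
  have hdiv : EqOn (minkowskiDiv η) (minkowskiDiv X) (cylinderEps n T ε) := fun p hp => by
    refine minkowskiDiv_congr ?_
    filter_upwards [(isOpen_cylinderEps n T ε).mem_nhds hp] with q hq
      using (hXη q hq.1 (Ioo_subset_Icc_self hq.2)).symm
  have hlat {r : ℝ} (hr : r ∈ Icc ε (1 - ε)) : lateralIntegral T r (fun p => η p (radial p)) =
      lateralIntegral T r fun p => X p (radial p) :=
    lateralIntegral_congr (hε.le.trans hr.1) fun p ht hp => by rw [hXη p ht (hp ▸ hr)]
  rw [setIntegral_congr_fun (isOpen_cylinderEps n T ε).measurableSet hdiv,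
    setIntegral_cylinderEps_minkowskiDiv_of_hasCompactSupport hn hX hXc hX_supp hε hε',
    normalFlux_eq hε hε', normalFlux_eq hε hε', hlat ⟨by linarith, le_rfl⟩,
    hlat ⟨le_rfl, by linarith⟩]

end DivergenceTheorem

section TwistedDerivative

variable {n : ℕ} {κ : ℝ} {φ u f z : Spacetime n → ℝ} {p : Spacetime n}

theorem yFun_pos (hp : ‖p.2‖ < 1) : 0 < yFun p := sub_pos.2 hp

theorem hasFDerivAt_yFun (hp : p.2 ≠ 0) : HasFDerivAt yFun (-radialCovector p) p :=
  (hasFDerivAt_norm_snd hp).const_sub 1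

theorem fderiv_yFun (hp : p.2 ≠ 0) : fderiv ℝ yFun p = -radialCovector p :=
  (hasFDerivAt_yFun hp).fderiv

theorem eventually_snd_ne_zero_and_norm_snd_lt_one (hp : p.2 ≠ 0) (hp' : ‖p.2‖ < 1) :
    ∀ᶠ q in 𝓝 p, q.2 ≠ 0 ∧ ‖q.2‖ < 1 :=
  (continuousAt_snd.eventually_ne hp).and (continuousAt_snd.norm.eventually_lt_const hp')

theorem twistedD_eq (hφ : DifferentiableAt ℝ φ p) (hp : p.2 ≠ 0) (hp' : ‖p.2‖ < 1) :
    twistedD κ φ p = fderiv ℝ φ p + (κ / yFun p * φ p) • radialCovector p := by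
  have hy := yFun_pos hp'
  have h := ((hasFDerivAt_yFun hp).rpow_const (p := -κ) (.inl hy.ne')).fun_mul hφ.hasFDerivAt
  have hyκ : yFun p ^ κ * yFun p ^ (-κ) = 1 := by rw [← Real.rpow_add hy]; simp
  rw [twistedD, h.fderiv, Real.rpow_sub_one hy.ne']
  refine ContinuousLinearMap.ext fun v => ?_
  simp only [smul_apply, add_apply, neg_apply, smul_eq_mul]
  linear_combination (fderiv ℝ φ p v + κ / yFun p * φ p * radialCovector p v) * hyκ

theorem twistedD_eventuallyEq (hu : ContDiffAt ℝ 2 u p) (hp : p.2 ≠ 0) (hp' : ‖p.2‖ < 1) :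
    twistedD κ u =ᶠ[𝓝 p] fun q => fderiv ℝ u q + (κ * (yFun q)⁻¹ * u q) • radialCovector q := by
  filter_upwards [hu.eventually (by simp),
    eventually_snd_ne_zero_and_norm_snd_lt_one hp hp'] with q hq ⟨hq0, hq1⟩
  rw [twistedD_eq (hq.differentiableAt two_ne_zero) hq0 hq1, div_eq_mul_inv]

theorem contDiffAt_yFun {k : WithTop ℕ∞} (hp : p.2 ≠ 0) :
    ContDiffAt ℝ k (yFun (n := n)) p :=
  contDiffAt_const.sub (contDiffAt_snd.norm ℝ hp)

theorem contDiffAt_twistedD (hu : ContDiffAt ℝ 2 u p) (hp : p.2 ≠ 0) (hp' : ‖p.2‖ < 1) :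
    ContDiffAt ℝ 1 (twistedD κ u) p :=
  .congr_of_eventuallyEq ((hu.fderiv_right le_rfl).add (((contDiffAt_const.mul
    ((contDiffAt_yFun hp).inv (yFun_pos hp').ne')).mul (hu.of_le one_le_two)).smul
      (contDiffAt_radialCovector hp))) (twistedD_eventuallyEq hu hp hp')

theorem fderiv_eq_twistedD_sub (hφ : DifferentiableAt ℝ φ p) (hp : p.2 ≠ 0) (hp' : ‖p.2‖ < 1) :
    fderiv ℝ φ p = twistedD κ φ p - (κ / yFun p * φ p) • radialCovector p :=
  eq_sub_of_add_eq (twistedD_eq hφ hp hp').symm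

theorem wFun_eq (hp : p.2 ≠ 0) :
    wFun κ f z p = 1 / 2 * (waveOp f p - 2 * κ / yFun p * fderiv ℝ f p (radial p)) + z p := by
  rw [wFun, fderiv_yFun hp, contract_comm, contract_eq_apply_sharp, neg_apply,
    radialCovector_sharp, mul_neg, ← sub_eq_add_neg]

theorem twistedDbar_eq_twistedD_neg (κ : ℝ) (φ : Spacetime n → ℝ) :
    twistedDbar κ φ = twistedD (-κ) φ := by
  funext p
  rw [twistedDbar, twistedD, neg_neg]

theorem twistedWaveOp_eq (hDu : DifferentiableAt ℝ (twistedD κ u) p) (hp : p.2 ≠ 0)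
    (hp' : ‖p.2‖ < 1) :
    twistedWaveOp κ u p =
      minkowskiDiv (twistedD κ u) p - κ / yFun p * twistedD κ u p (radial p) := by
  have (v : Spacetime n) : DifferentiableAt ℝ (fun q => twistedD κ u q v) p :=
    hDu.clm_apply (differentiableAt_const v)
  rw [← contract_radialCovector]
  simp only [twistedWaveOp, twistedDbar_eq_twistedD_neg, twistedD_eq (this _) hp hp', minkowskiDiv,
    contract, Finset.mul_sum, ← Finset.sum_sub_distrib, add_apply, smul_apply, smul_eq_mul]
  refine Finset.sum_congr rfl fun α _ => Finset.sum_congr rfl fun β _ => by ring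

end TwistedDerivative

section EnergyCurrent

variable {n : ℕ} {κ : ℝ} {u f z : Spacetime n → ℝ} {p : Spacetime n}

theorem apply_sharp_comm (a b : Spacetime n →L[ℝ] ℝ) : a (sharp b) = b (sharp a) := by
  rw [← contract_eq_apply_sharp, contract_comm, contract_eq_apply_sharp]

theorem hasFDerivAt_contract {η ζ : Spacetime n → Spacetime n →L[ℝ] ℝ}
    (hη : DifferentiableAt ℝ η p) (hζ : DifferentiableAt ℝ ζ p) :
    HasFDerivAt (fun q => contract (η q) (ζ q))
      ((ζ p).comp (sharp.comp (fderiv ℝ η p)) + (fderiv ℝ ζ p).flip (sharp (η p))) p := by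
  simp only [contract_eq_apply_sharp]
  exact hζ.hasFDerivAt.clm_apply (sharp.hasFDerivAt.comp p hη.hasFDerivAt)

/-- The current whose divergence is the integrand of the multiplier identity for
`□_y u · S_{f,z} u`. -/
noncomputable def energyCurrent (κ : ℝ) (f z u : Spacetime n → ℝ) :
    Spacetime n → Spacetime n →L[ℝ] ℝ :=
  -multiplier κ f z u • twistedD κ u
    + (fun p => 1 / 2 * contract (twistedD κ u p) (twistedD κ u p)) • fderiv ℝ f
    + (fun p => 1 / 2 * u p ^ 2) • fderiv ℝ (wFun κ f z)

theorem fderiv_twistedD_sub_swap (hu : ContDiffAt ℝ 2 u p) (hp : p.2 ≠ 0) (hp' : ‖p.2‖ < 1)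
    (v w : Spacetime n) :
    fderiv ℝ (twistedD κ u) p v w - fderiv ℝ (twistedD κ u) p w v =
      κ / yFun p * (twistedD κ u p v * radialCovector p w
        - twistedD κ u p w * radialCovector p v) := by
  have hr : ‖p.2‖ ≠ 0 := norm_ne_zero_iff.2 hp
  have hy : yFun p ≠ 0 := (yFun_pos hp').ne'
  have hdu : DifferentiableAt ℝ (fderiv ℝ u) p :=
    (hu.fderiv_right le_rfl).differentiableAt one_ne_zero
  have hdr : DifferentiableAt ℝ (radialCovector (n := n)) p :=
    (contDiffAt_radialCovector hp).differentiableAt one_ne_zero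
  have hinv : HasFDerivAt (fun q => (yFun q)⁻¹) (-(yFun p ^ 2)⁻¹ • -radialCovector p) p :=
    (hasDerivAt_inv hy).comp_hasFDerivAt p (hasFDerivAt_yFun hp)
  have hc := (hinv.const_mul κ).fun_mul (hu.differentiableAt two_ne_zero).hasFDerivAt
  have hsymm := hu.isSymmSndFDerivAt (by simp) v w
  rw [(twistedD_eventuallyEq hu hp hp').fderiv_eq,
    (hdu.hasFDerivAt.fun_add (hc.fun_smul hdr.hasFDerivAt)).fderiv,
    twistedD_eq (hu.differentiableAt two_ne_zero) hp hp']
  simp only [smul_neg, neg_smul, neg_neg, add_apply, smul_apply,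
    ContinuousLinearMap.smulRight_apply, smul_eq_mul, hsymm, fderiv_radialCovector hp,
    real_inner_comm, add_sub_add_left_eq_sub]
  field_simp
  ring

theorem minkowskiDiv_energyCurrent (hu : ContDiffAt ℝ 2 u p) (hf : ContDiffAt ℝ 2 f p)
    (hw : ContDiffAt ℝ 2 (wFun κ f z) p) (hp : p.2 ≠ 0) (hp' : ‖p.2‖ < 1) :
    minkowskiDiv (energyCurrent κ f z u) p =
      -(twistedWaveOp κ u p * multiplier κ f z u p)
        - fderiv ℝ (fderiv ℝ f) p (sharp (twistedD κ u p)) (sharp (twistedD κ u p))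
        - z p * contract (twistedD κ u p) (twistedD κ u p)
        + 1 / 2 * u p ^ 2 * (waveOp (wFun κ f z) p
          - 2 * κ / yFun p * fderiv ℝ (wFun κ f z) p (radial p)) := by
  have hDu := (contDiffAt_twistedD (κ := κ) hu hp hp').differentiableAt one_ne_zero
  have hdf : DifferentiableAt ℝ (fderiv ℝ f) p :=
    (hf.fderiv_right le_rfl).differentiableAt one_ne_zero
  have hdw : DifferentiableAt ℝ (fderiv ℝ (wFun κ f z)) p :=
    (hw.fderiv_right le_rfl).differentiableAt one_ne_zero
  have hdu := (hu.differentiableAt two_ne_zero).hasFDerivAt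
  have hS : HasFDerivAt (multiplier κ f z u) _ p :=
    (hasFDerivAt_contract hdf hDu).fun_add
      ((hw.differentiableAt two_ne_zero).hasFDerivAt.fun_mul hdu)
  have hq := (hasFDerivAt_contract hDu hDu).const_mul (1 / 2)
  have hu2 := (hdu.pow 2).const_mul (1 / 2)
  have hswap := fderiv_twistedD_sub_swap hu hp hp' (κ := κ) (sharp (fderiv ℝ f p))
    (sharp (twistedD κ u p))
  have h₁ := hS.neg.differentiableAt.smul hDu
  have h₂ := hq.differentiableAt.smul hdf
  have h₃ := hu2.differentiableAt.smul hdw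
  rw [energyCurrent, minkowskiDiv_add (h₁.add h₂) h₃, minkowskiDiv_add h₁ h₂,
    minkowskiDiv_smul hS.neg.differentiableAt hDu, minkowskiDiv_smul hq.differentiableAt hdf,
    minkowskiDiv_smul hu2.differentiableAt hdw, hS.neg.fderiv, hq.fderiv, hu2.fderiv,
    twistedWaveOp_eq hDu hp hp', ← waveOp_eq_minkowskiDiv_fderiv, ← waveOp_eq_minkowskiDiv_fderiv,
    contract_comm _ (twistedD κ u p), contract_comm _ (fderiv ℝ f p),
    contract_comm _ (fderiv ℝ (wFun κ f z) p), multiplier]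
  simp only [fderiv_eq_twistedD_sub hdu.differentiableAt hp hp' (κ := κ), multiplier,
    contract_eq_apply_sharp, add_apply, smul_apply, sub_apply, smul_eq_mul,
    ContinuousLinearMap.flip_apply, ContinuousLinearMap.comp_apply, neg_apply, Pi.neg_apply,
    radialCovector_sharp] at hswap ⊢
  rw [apply_sharp_comm (twistedD κ u p) (fderiv ℝ (fderiv ℝ f) p _),
    apply_sharp_comm (twistedD κ u p) (fderiv ℝ (twistedD κ u) p _),
    apply_sharp_comm (fderiv ℝ (wFun κ f z) p) (twistedD κ u p)]
  linear_combination hswap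
    - twistedD κ u p (sharp (twistedD κ u p)) * wFun_eq hp (κ := κ) (f := f) (z := z)

end EnergyCurrent

section AngularGradient

variable {n : ℕ} {κ : ℝ} {u : Spacetime n → ℝ} {p : Spacetime n}

theorem norm_sq_starProjection_orthogonal_span_singleton {E : Type*} [NormedAddCommGroup E]
    [InnerProductSpace ℝ E] {x : E} (hx : x ≠ 0) (v : E) :
    ‖(ℝ ∙ x)ᗮ.starProjection v‖ ^ 2 = ‖v‖ ^ 2 - inner ℝ (‖x‖⁻¹ • x) v ^ 2 := by
  have hx' : ‖x‖ ≠ 0 := norm_ne_zero_iff.2 hx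
  have h : ‖(ℝ ∙ x).starProjection v‖ ^ 2 = inner ℝ (‖x‖⁻¹ • x) v ^ 2 := by
    rw [Submodule.starProjection_singleton, norm_smul, mul_pow, Real.norm_eq_abs, sq_abs,
      real_inner_smul_left, RCLike.ofReal_real_eq_id, id]
    field_simp
  rw [Submodule.norm_sq_eq_add_norm_sq_starProjection v (ℝ ∙ x), h, add_sub_cancel_left]

theorem gradient_eq_sharp_fderiv (hu : DifferentiableAt ℝ u p) :
    gradient (fun x => u (p.1, x)) p.2 = (sharp (fderiv ℝ u p)).2 := by
  have h : HasFDerivAt (fun x => u (p.1, x)) ((fderiv ℝ u p).comp (.inr ℝ ℝ _)) p.2 :=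
    hu.hasFDerivAt.comp p.2 (hasFDerivAt_prodMk_right p.1 p.2)
  refine ext_inner_right ℝ fun v => ?_
  rw [inner_sharp_snd, gradient, InnerProductSpace.toDual_symm_apply, h.fderiv]
  rfl

theorem angularGrad_eq (hu : DifferentiableAt ℝ u p) (hp : p.2 ≠ 0) (hp' : ‖p.2‖ < 1) :
    angularGrad u p = (ℝ ∙ p.2)ᗮ.starProjection (sharp (twistedD κ u p)).2 := by
  have hmem : (radial p).2 ∈ ((ℝ ∙ p.2)ᗮ)ᗮ :=
    Submodule.le_orthogonal_orthogonal _
      (Submodule.smul_mem _ _ (Submodule.mem_span_singleton_self p.2))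
  rw [angularGrad, gradient_eq_sharp_fderiv hu, fderiv_eq_twistedD_sub (κ := κ) hu hp hp', map_sub,
    map_smul, sharp_radialCovector, Prod.snd_sub, Prod.smul_snd, map_sub, map_smul,
    (Submodule.starProjection_apply_eq_zero_iff _).2 hmem, smul_zero, sub_zero]

theorem norm_sq_angularGrad (hu : DifferentiableAt ℝ u p) (hp : p.2 ≠ 0) (hp' : ‖p.2‖ < 1) :
    ‖angularGrad u p‖ ^ 2 =
      ‖(sharp (twistedD κ u p)).2‖ ^ 2 - twistedD κ u p (radial p) ^ 2 := by
  rw [angularGrad_eq (κ := κ) hu hp hp', norm_sq_starProjection_orthogonal_span_singleton hp,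
    real_inner_comm, inner_sharp_snd]
  rfl

theorem twistedD_time (hu : DifferentiableAt ℝ u p) (hp : p.2 ≠ 0) (hp' : ‖p.2‖ < 1) :
    twistedD κ u p (1, 0) = timeDeriv u p := by
  simp [twistedD_eq hu hp hp', timeDeriv, radialCovector_apply]

end AngularGradient

section RadialMonomial

variable {n : ℕ} {a : ℝ} {m : ℤ} {p : Spacetime n}

theorem minkowskiDiv_radialCovector (hp : p.2 ≠ 0) :
    minkowskiDiv radialCovector p = (n - 1) / ‖p.2‖ := by
  have hdr : DifferentiableAt ℝ (radialCovector (n := n)) p :=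
    (contDiffAt_radialCovector hp).differentiableAt one_ne_zero
  have hunit : ∑ i, radialCovector p (0, EuclideanSpace.single i 1) ^ 2 = 1 := by
    refine Eq.trans ?_ (radialCovector_radial hp)
    rw [radialCovector_apply p (radial p), real_inner_self_eq_norm_sq,
      EuclideanSpace.real_norm_sq_eq]
    simp [radialCovector_apply, EuclideanSpace.inner_single_right]
  have htime : radialCovector p (1, 0) = 0 := by simp [radialCovector_apply]
  simp only [minkowskiDiv_eq_of_hasFDerivAt hdr.hasFDerivAt, fderiv_radialCovector hp,
    sum_minkowski_mul, frame, Fin.cons_zero, Fin.cons_succ, htime, ← Finset.sum_div,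
    Finset.sum_sub_distrib, ← sq, hunit]
  simp

theorem minkowskiDiv_smul_radialCovector {φ : Spacetime n → ℝ} {φ' : ℝ}
    (hφ : HasFDerivAt φ (φ' • radialCovector p) p) (hp : p.2 ≠ 0) :
    minkowskiDiv (φ • radialCovector) p = φ' + (n - 1) / ‖p.2‖ * φ p := by
  rw [minkowskiDiv_smul hφ.differentiableAt
    ((contDiffAt_radialCovector hp).differentiableAt one_ne_zero), hφ.fderiv, contract_smul_left,
    contract_radialCovector, radialCovector_radial hp, minkowskiDiv_radialCovector hp]
  ring

/-- The monomials `y^a r^m`, from which all radial weights are built. -/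
noncomputable def radialMonomial (a : ℝ) (m : ℤ) (p : Spacetime n) : ℝ :=
  yFun p ^ a * ‖p.2‖ ^ m

theorem hasFDerivAt_radialMonomial (hp : p.2 ≠ 0) (hp' : ‖p.2‖ < 1) :
    HasFDerivAt (radialMonomial a m) ((-a * radialMonomial (a - 1) m p
      + m * radialMonomial a (m - 1) p) • radialCovector p) p := by
  have hr := hasFDerivAt_comp_norm_snd (hasDerivAt_zpow m _ (.inl (norm_ne_zero_iff.2 hp))) hp
  refine (((hasFDerivAt_yFun hp).rpow_const (.inl (yFun_pos hp').ne')).mul hr).congr_fderiv ?_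
  simp only [radialMonomial]
  module

theorem contDiffAt_radialMonomial {k : WithTop ℕ∞} (hp : p.2 ≠ 0) (hp' : ‖p.2‖ < 1) :
    ContDiffAt ℝ k (radialMonomial a m) p := by
  have hnorm : ContDiffAt ℝ k (fun q : Spacetime n => ‖q.2‖) p := contDiffAt_snd.norm ℝ hp
  refine ((contDiffAt_yFun hp).rpow_const_of_ne (yFun_pos hp').ne').mul ?_
  cases m with
  | ofNat m => simpa using hnorm.pow m
  | negSucc m =>
    simp only [zpow_negSucc]
    exact (hnorm.pow (m + 1)).inv (pow_ne_zero _ (norm_ne_zero_iff.2 hp))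

end RadialMonomial

section Weights

variable {n : ℕ} {κ c : ℝ} {p : Spacetime n}

theorem hasFDerivAt_fFun (hκ : 1 + 2 * κ ≠ 0) (c : ℝ) (hp : p.2 ≠ 0) (hp' : ‖p.2‖ < 1) :
    HasFDerivAt (fFun κ c) (radialMonomial (2 * κ) 0 p • radialCovector p
      + (-2 * c * p.1) • .fst ℝ ℝ _) p := by
  have hy := ((hasFDerivAt_yFun hp).rpow_const (p := 1 + 2 * κ)
    (.inl (yFun_pos hp').ne')).const_mul (-(1 / (1 + 2 * κ)))
  have ht := ((hasFDerivAt_fst (𝕜 := ℝ) (p := p)).pow 2).const_mul c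
  refine (hy.sub ht).congr_fderiv (ContinuousLinearMap.ext fun v => ?_)
  simp only [radialMonomial, add_sub_cancel_left, zpow_zero, mul_one, add_apply, sub_apply,
    smul_apply, neg_apply, smul_eq_mul, nsmul_eq_mul]
  field_simp
  ring

theorem contDiffAt_fFun {k : WithTop ℕ∞} (κ c : ℝ) (hp : p.2 ≠ 0) (hp' : ‖p.2‖ < 1) :
    ContDiffAt ℝ k (fFun κ c) p :=
  (contDiffAt_const.mul ((contDiffAt_yFun hp).rpow_const_of_ne (yFun_pos hp').ne')).sub
    (contDiffAt_const.mul (contDiffAt_fst.pow 2))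

theorem fderiv_fFun_eventuallyEq (hκ : 1 + 2 * κ ≠ 0) (c : ℝ) (hp : p.2 ≠ 0) (hp' : ‖p.2‖ < 1) :
    fderiv ℝ (fFun κ c) =ᶠ[𝓝 p]
      (radialMonomial (2 * κ) 0 : Spacetime n → ℝ) • radialCovector
      + (fun q : Spacetime n => -2 * c * q.1) • fun _ => .fst ℝ ℝ _ := by
  filter_upwards [eventually_snd_ne_zero_and_norm_snd_lt_one hp hp'] with q hq
  exact (hasFDerivAt_fFun hκ c hq.1 hq.2).fderiv

theorem fderiv_fderiv_fFun_apply_self (hκ : 1 + 2 * κ ≠ 0) (c : ℝ) (hp : p.2 ≠ 0)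
    (hp' : ‖p.2‖ < 1) (v : Spacetime n) :
    fderiv ℝ (fderiv ℝ (fFun κ c)) p v v =
      radialMonomial (2 * κ) (-1) p * (‖v.2‖ ^ 2 - radialCovector p v ^ 2)
        - 2 * κ * radialMonomial (2 * κ - 1) 0 p * radialCovector p v ^ 2 - 2 * c * v.1 ^ 2 := by
  have hdr := ((contDiffAt_radialCovector (k := 1) hp).differentiableAt one_ne_zero).hasFDerivAt
  have hs := hasFDerivAt_radialMonomial (a := 2 * κ) (m := 0) hp hp'
  have ht := (hasFDerivAt_fst (𝕜 := ℝ) (p := p)).const_mul (-2 * c)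
  rw [(fderiv_fFun_eventuallyEq hκ c hp hp').fderiv_eq,
    ((hs.smul hdr).add (ht.smul (hasFDerivAt_const _ p))).fderiv]
  simp only [radialMonomial, zpow_ofNat, pow_zero, mul_one, neg_mul, Int.cast_zero, zero_sub,
    Int.reduceNeg, zpow_neg, pow_one, zero_mul, add_zero, smul_zero, neg_smul, zero_add, add_apply,
    smul_apply, ContinuousLinearMap.smulRight_apply, smul_eq_mul, neg_apply,
    ContinuousLinearMap.coe_fst', fderiv_radialCovector hp, inner_self_eq_norm_sq_to_K,
    Real.ringHom_apply]
  ring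

theorem waveOp_fFun (hκ : 1 + 2 * κ ≠ 0) (c : ℝ) (hp : p.2 ≠ 0) (hp' : ‖p.2‖ < 1) :
    waveOp (fFun κ c) p = (n - 1) * radialMonomial (2 * κ) (-1) p
      - 2 * κ * radialMonomial (2 * κ - 1) 0 p + 2 * c := by
  have hdr := (contDiffAt_radialCovector (k := 1) hp).differentiableAt one_ne_zero
  have hs := hasFDerivAt_radialMonomial (a := 2 * κ) (m := 0) hp hp'
  have ht := (hasFDerivAt_fst (𝕜 := ℝ) (p := p)).const_mul (-2 * c)
  rw [waveOp_eq_minkowskiDiv_fderiv, minkowskiDiv_congr (fderiv_fFun_eventuallyEq hκ c hp hp'),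
    minkowskiDiv_add (hs.differentiableAt.smul hdr)
      (ht.differentiableAt.smul (differentiableAt_const _)),
    minkowskiDiv_smul_radialCovector hs hp,
    minkowskiDiv_smul ht.differentiableAt (differentiableAt_const _), ht.fderiv,
    contract_smul_left, contract_self]
  simp only [radialMonomial, zpow_ofNat, pow_zero, mul_one, neg_mul, Int.cast_zero, zero_sub,
    Int.reduceNeg, zpow_neg, pow_one, zero_mul, add_zero, minkowskiDiv,
    ContinuousLinearMap.coe_fst', fderiv_fun_const, Pi.zero_apply, zero_apply, mul_zero,
    Finset.sum_const_zero, sharp_eq, zero_smul, norm_zero, ne_eq, OfNat.ofNat_ne_zero,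
    not_false_eq_true, zero_pow, one_pow, mul_neg, neg_neg, zero_add, add_left_inj]
  ring

theorem wFun_fFun_zFun (hκ : 1 + 2 * κ ≠ 0) (c : ℝ) (hp : p.2 ≠ 0) (hp' : ‖p.2‖ < 1) :
    wFun κ (fFun κ c) (zFun c) p = (n - 1) / 2 * radialMonomial (2 * κ) (-1) p
      - 2 * κ * radialMonomial (2 * κ - 1) 0 p - 3 * c := by
  rw [wFun_eq hp, waveOp_fFun hκ c hp hp', (hasFDerivAt_fFun hκ c hp hp').fderiv, zFun]
  simp only [one_div, radialMonomial, Int.reduceNeg, zpow_neg, zpow_ofNat, pow_one,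
    Real.rpow_sub_one (yFun_pos hp').ne', pow_zero, mul_one, neg_mul, add_apply, smul_apply,
    radialCovector_radial hp, smul_eq_mul, ContinuousLinearMap.coe_fst',
    show (radial p).1 = 0 from rfl, mul_zero, add_zero]
  ring

theorem wFun_eventuallyEq (hκ : 1 + 2 * κ ≠ 0) (c : ℝ) (hp : p.2 ≠ 0) (hp' : ‖p.2‖ < 1) :
    wFun κ (fFun κ c) (zFun c) =ᶠ[𝓝 p] fun q => (n - 1) / 2 * radialMonomial (2 * κ) (-1) q
      - 2 * κ * radialMonomial (2 * κ - 1) 0 q - 3 * c := by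
  filter_upwards [eventually_snd_ne_zero_and_norm_snd_lt_one hp hp'] with q hq
  exact wFun_fFun_zFun hκ c hq.1 hq.2

theorem contDiffAt_wFun {k : WithTop ℕ∞} (hκ : 1 + 2 * κ ≠ 0) (c : ℝ) (hp : p.2 ≠ 0)
    (hp' : ‖p.2‖ < 1) : ContDiffAt ℝ k (wFun κ (fFun κ c) (zFun c)) p :=
  .congr_of_eventuallyEq (((contDiffAt_const.mul (contDiffAt_radialMonomial hp hp')).sub
    (contDiffAt_const.mul (contDiffAt_radialMonomial hp hp'))).sub contDiffAt_const)
    (wFun_eventuallyEq hκ c hp hp')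

/-- The radial derivative of the weight `w_{f,z}`. -/
noncomputable def wFunDeriv (κ : ℝ) (p : Spacetime n) : ℝ :=
  2 * κ * (2 * κ - 1) * radialMonomial (2 * κ - 2) 0 p
    - (n - 1) * κ * radialMonomial (2 * κ - 1) (-1) p
    - (n - 1) / 2 * radialMonomial (2 * κ) (-2) p

theorem hasFDerivAt_wFun (hκ : 1 + 2 * κ ≠ 0) (c : ℝ) (hp : p.2 ≠ 0) (hp' : ‖p.2‖ < 1) :
    HasFDerivAt (wFun κ (fFun κ c) (zFun c)) (wFunDeriv κ p • radialCovector p) p := by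
  have hB (a : ℝ) (m : ℤ) := hasFDerivAt_radialMonomial (a := a) (m := m) hp hp'
  refine .congr_of_eventuallyEq ((((hB _ _).const_mul _).fun_sub
    ((hB _ _).const_mul _)).sub_const _ |>.congr_fderiv ?_)
    (wFun_eventuallyEq hκ c hp hp')
  rw [wFunDeriv, show 2 * κ - 2 = 2 * κ - 1 - 1 by ring]
  norm_num
  module

theorem rpow_sub_two {x : ℝ} (hx : x ≠ 0) (a : ℝ) : x ^ (a - 2) = x ^ a / x ^ 2 :=
  mod_cast Real.rpow_sub_natCast hx a 2

theorem hasFDerivAt_wFunDeriv (κ : ℝ) (hp : p.2 ≠ 0) (hp' : ‖p.2‖ < 1) :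
    HasFDerivAt (wFunDeriv (n := n) κ) ((yFun p ^ (2 * κ)
      * (-4 * κ * (2 * κ - 1) * (κ - 1) / yFun p ^ 3
        + (n - 1) * κ * (2 * κ - 1) / (yFun p ^ 2 * ‖p.2‖)
        + 2 * (n - 1) * κ / (yFun p * ‖p.2‖ ^ 2) + (n - 1) / ‖p.2‖ ^ 3)) • radialCovector p) p := by
  have hB (a : ℝ) (m : ℤ) := hasFDerivAt_radialMonomial (a := a) (m := m) hp hp'
  have hy : yFun p ≠ 0 := (yFun_pos hp').ne'
  refine ((((hB _ _).const_mul _).fun_sub ((hB _ _).const_mul _)).fun_sub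
    ((hB _ _).const_mul _)).congr_fderiv ?_
  simp only [smul_smul, ← sub_smul]
  congr 1
  simp only [neg_sub, radialMonomial, Real.rpow_sub_one hy, rpow_sub_two hy, zpow_ofNat, pow_zero,
    mul_one, Int.cast_zero, zero_sub, Int.reduceNeg, zpow_neg, pow_one, zero_mul, add_zero,
    Int.cast_neg, Int.cast_one, Int.reduceSub, neg_mul, one_mul, Int.cast_ofNat]
  field_simp
  ring

theorem waveOp_wFun_sub (hκ : 1 + 2 * κ ≠ 0) (c : ℝ) (hp : p.2 ≠ 0) (hp' : ‖p.2‖ < 1) :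
    waveOp (wFun κ (fFun κ c) (zFun c)) p
      - 2 * κ / yFun p * fderiv ℝ (wFun κ (fFun κ c) (zFun c)) p (radial p) =
      yFun p ^ (2 * κ) * (-4 * κ * (2 * κ - 1) ^ 2 / yFun p ^ 3
        + (n - 1) * κ * (8 * κ - 3) / (yFun p ^ 2 * ‖p.2‖)
        + (4 - n) * (n - 1) * κ / (yFun p * ‖p.2‖ ^ 2)
        + (n - 1) * (3 - n) / (2 * ‖p.2‖ ^ 3)) := by
  have hw : fderiv ℝ (wFun κ (fFun κ c) (zFun c)) =ᶠ[𝓝 p]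
      (wFunDeriv κ : Spacetime n → ℝ) • radialCovector := by
    filter_upwards [eventually_snd_ne_zero_and_norm_snd_lt_one hp hp'] with q hq
    exact (hasFDerivAt_wFun hκ c hq.1 hq.2).fderiv
  have hy : yFun p ≠ 0 := (yFun_pos hp').ne'
  rw [waveOp_eq_minkowskiDiv_fderiv, minkowskiDiv_congr hw,
    minkowskiDiv_smul_radialCovector (hasFDerivAt_wFunDeriv κ hp hp') hp, hw.self_of_nhds]
  simp only [neg_mul, wFunDeriv, radialMonomial, rpow_sub_two hy, zpow_ofNat, pow_zero, mul_one,
    Real.rpow_sub_one hy, Int.reduceNeg, zpow_neg, pow_one, Pi.smul_apply', smul_apply,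
    radialCovector_radial hp, smul_eq_mul]
  field_simp
  ring

end Weights

section CarlemanIdentity

variable {n : ℕ} {κ c : ℝ} {u : Spacetime n → ℝ} {p : Spacetime n}

/-- The current of the Hardy inequality that absorbs the `y^{2κ-3} u²` bulk term: adding its
divergence completes the square of `D_r u + (1 - 2κ) u / y`. -/
noncomputable def hardyCurrent (κ : ℝ) (u : Spacetime n → ℝ) :
    Spacetime n → Spacetime n →L[ℝ] ℝ :=
  (fun p => 2 * κ * (2 * κ - 1) * (yFun p ^ (2 * κ - 2) * u p ^ 2)) • fderiv ℝ yFun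

theorem minkowskiDiv_hardyCurrent (κ : ℝ) (hu : DifferentiableAt ℝ u p) (hp : p.2 ≠ 0)
    (hp' : ‖p.2‖ < 1) :
    minkowskiDiv (hardyCurrent κ u) p = 2 * κ * (1 - 2 * κ) * yFun p ^ (2 * κ) *
      ((2 - 4 * κ) * u p ^ 2 / yFun p ^ 3 + (n - 1) * u p ^ 2 / (yFun p ^ 2 * ‖p.2‖)
        + 2 * u p * twistedD κ u p (radial p) / yFun p ^ 2) := by
  have hy : yFun p ≠ 0 := (yFun_pos hp').ne'
  have hdr := (contDiffAt_radialCovector (k := 1) hp).differentiableAt one_ne_zero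
  have hw := (((hasFDerivAt_yFun hp).rpow_const (p := 2 * κ - 2) (.inl hy)).fun_mul
    (hu.hasFDerivAt.pow 2)).const_mul (2 * κ * (1 - 2 * κ))
  have hdy : hardyCurrent κ u =ᶠ[𝓝 p]
      (fun q => 2 * κ * (1 - 2 * κ) * (yFun q ^ (2 * κ - 2) * u q ^ 2)) • radialCovector := by
    filter_upwards [eventually_snd_ne_zero_and_norm_snd_lt_one hp hp'] with q hq
    simp only [hardyCurrent, Pi.smul_apply', fderiv_yFun hq.1]
    module
  rw [minkowskiDiv_congr hdy, minkowskiDiv_smul hw.differentiableAt hdr, hw.fderiv,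
    contract_comm, contract_radialCovector, minkowskiDiv_radialCovector hp, twistedD_eq hu hp hp']
  simp only [rpow_sub_two hy, Nat.add_one_sub_one, pow_one, nsmul_eq_mul, Nat.cast_ofNat,
    Real.rpow_sub_one hy, smul_neg, smul_add, add_apply, smul_apply, smul_eq_mul, neg_apply,
    radialCovector_radial hp, mul_one]
  field_simp
  ring

/-- The bulk integrand on the right-hand side of the Carleman estimate. -/
noncomputable def carlemanBulk (κ c : ℝ) (u : Spacetime n → ℝ) (p : Spacetime n) : ℝ :=
  ((1 - 4 * c) * ‖angularGrad u p‖ ^ 2 + 2 * c * timeDeriv u p ^ 2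
      - 4 * c * twistedD κ u p (radial p) ^ 2)
    - (1 / 2) * (n - 1) * κ * (yFun p ^ (2 * κ - 2) * (‖p.2‖ ^ 2)⁻¹ *
      (‖p.2‖ - (n - 4) * yFun p) * u p ^ 2)
    + (1 / 4) * (n - 1) * (n - 3) * (yFun p ^ (2 * κ) * (‖p.2‖ ^ 3)⁻¹ * u p ^ 2)

theorem carleman_identity (hκ : 1 + 2 * κ ≠ 0) (c : ℝ) (hu : ContDiffAt ℝ 2 u p)
    (hp : p.2 ≠ 0) (hp' : ‖p.2‖ < 1) :
    -(twistedWaveOp κ u p * multiplier κ (fFun κ c) (zFun c) u p) =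
      carlemanBulk κ c u p
        + (yFun p ^ (2 * κ) / ‖p.2‖ - 1) * ‖angularGrad u p‖ ^ 2
        - 2 * κ * yFun p ^ (2 * κ - 1) *
          (twistedD κ u p (radial p) + (1 - 2 * κ) * u p / yFun p) ^ 2
        + minkowskiDiv (energyCurrent κ (fFun κ c) (zFun c) u) p
        + minkowskiDiv (hardyCurrent κ u) p := by
  have hy : yFun p ≠ 0 := (yFun_pos hp').ne'
  have hdu := hu.differentiableAt two_ne_zero
  rw [minkowskiDiv_energyCurrent hu (contDiffAt_fFun κ c hp hp')
      (contDiffAt_wFun hκ c hp hp') hp hp',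
    minkowskiDiv_hardyCurrent κ hdu hp hp',
    waveOp_wFun_sub hκ c hp hp', fderiv_fderiv_fFun_apply_self hκ c hp hp', contract_self,
    carlemanBulk, norm_sq_angularGrad (κ := κ) hdu hp hp', twistedD_time hdu hp hp', zFun,
    radialCovector_sharp, show (sharp (twistedD κ u p)).1 = -timeDeriv u p by
      rw [sharp_eq, twistedD_time hdu hp hp']]
  simp only [one_div, rpow_sub_two hy, Real.rpow_sub_one hy, radialMonomial, Int.reduceNeg,
    zpow_neg, zpow_ofNat, pow_one, pow_zero, mul_one, even_two, Even.neg_pow, neg_mul,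
    sub_neg_eq_add]
  field_simp
  ring

theorem carleman_estimate (hκ : 1 + 2 * κ ≠ 0) (hκ' : κ ≤ 0) (c : ℝ) (hu : ContDiffAt ℝ 2 u p)
    (hp : p.2 ≠ 0) (hp' : ‖p.2‖ < 1) :
    carlemanBulk κ c u p + minkowskiDiv (energyCurrent κ (fFun κ c) (zFun c) u) p
        + minkowskiDiv (hardyCurrent κ u) p ≤
      -(twistedWaveOp κ u p * multiplier κ (fFun κ c) (zFun c) u p) := by
  have hy := yFun_pos hp'
  have hr : 0 < ‖p.2‖ := norm_pos_iff.2 hp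
  have hweight : 1 ≤ yFun p ^ (2 * κ) / ‖p.2‖ := by
    rw [one_le_div hr]
    exact hp'.le.trans (Real.one_le_rpow_of_pos_of_le_one_of_nonpos hy (sub_le_self 1 hr.le)
      (by linarith))
  have hang : 0 ≤ (yFun p ^ (2 * κ) / ‖p.2‖ - 1) * ‖angularGrad u p‖ ^ 2 :=
    mul_nonneg (sub_nonneg.2 hweight) (sq_nonneg _)
  have hsq : 0 ≤ -2 * κ * yFun p ^ (2 * κ - 1) *
      (twistedD κ u p (radial p) + (1 - 2 * κ) * u p / yFun p) ^ 2 :=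
    mul_nonneg (mul_nonneg (by linarith) (Real.rpow_nonneg hy.le _)) (sq_nonneg _)
  rw [carleman_identity hκ c hu hp hp']
  linarith

end CarlemanIdentity

section PuncturedCylinder

variable {n : ℕ} {T : ℝ}

theorem contDiffOn_fderiv_puncturedCylinder {φ : Spacetime n → ℝ}
    (hφ : ContDiffOn ℝ 2 φ (puncturedCylinder n T)) :
    ContDiffOn ℝ 1 (fderiv ℝ φ) (puncturedCylinder n T) :=
  hφ.fderiv_of_isOpen (isOpen_puncturedCylinder n T) one_add_one_eq_two.le

theorem contDiffOn_yFun (k : WithTop ℕ∞) : ContDiffOn ℝ k yFun (puncturedCylinder n T) :=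
  fun _ hp => (contDiffAt_yFun (snd_ne_zero_of_mem_puncturedCylinder hp)).contDiffWithinAt

theorem contDiffOn_yFun_rpow (a : ℝ) (k : WithTop ℕ∞) :
    ContDiffOn ℝ k (fun p => yFun p ^ a) (puncturedCylinder n T) :=
  (contDiffOn_yFun k).rpow_const_of_ne fun _ hp => (yFun_pos hp.2.2).ne'

theorem contDiffOn_fFun (κ c : ℝ) (k : WithTop ℕ∞) :
    ContDiffOn ℝ k (fFun κ c) (puncturedCylinder n T) := fun _ hp =>
  (contDiffAt_fFun κ c (snd_ne_zero_of_mem_puncturedCylinder hp) hp.2.2).contDiffWithinAt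

theorem contDiffOn_wFun {κ : ℝ} (hκ : 1 + 2 * κ ≠ 0) (c : ℝ) (k : WithTop ℕ∞) :
    ContDiffOn ℝ k (wFun κ (fFun κ c) (zFun c)) (puncturedCylinder n T) := fun _ hp =>
  (contDiffAt_wFun hκ c (snd_ne_zero_of_mem_puncturedCylinder hp) hp.2.2).contDiffWithinAt

end PuncturedCylinder

namespace Admissible

variable {n : ℕ} {T δ : ℝ} {k l : WithTop ℕ∞} {V : Type*} [NormedAddCommGroup V] [NormedSpace ℝ V]
  {F G : Spacetime n → V} {φ : Spacetime n → ℝ} {η ζ : Spacetime n → Spacetime n →L[ℝ] ℝ}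
  {p : Spacetime n}

theorem of_contDiffAt (hF : ∀ p ∈ puncturedCylinder n T, ContDiffAt ℝ k F p)
    (h0 : ∀ p ∈ puncturedCylinder n T, T - δ < |p.1| → F p = 0) : Admissible T δ k F :=
  ⟨fun p hp => (hF p hp).contDiffWithinAt, h0⟩

theorem of_le (hF : Admissible T δ k F) (hl : l ≤ k) : Admissible T δ l F :=
  ⟨hF.contDiffOn.of_le hl, hF.eq_zero⟩

theorem congr (hF : Admissible T δ k F) (h : EqOn G F (puncturedCylinder n T)) :
    Admissible T δ k G :=
  ⟨hF.contDiffOn.congr h, fun p hp ht => (h hp).trans (hF.eq_zero p hp ht)⟩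

theorem add (hF : Admissible T δ k F) (hG : Admissible T δ k G) : Admissible T δ k (F + G) :=
  ⟨hF.contDiffOn.add hG.contDiffOn, fun p hp ht => by
    rw [Pi.add_apply, hF.eq_zero p hp ht, hG.eq_zero p hp ht, add_zero]⟩

theorem sub (hF : Admissible T δ k F) (hG : Admissible T δ k G) : Admissible T δ k (F - G) :=
  ⟨hF.contDiffOn.sub hG.contDiffOn, fun p hp ht => by
    rw [Pi.sub_apply, hF.eq_zero p hp ht, hG.eq_zero p hp ht, sub_zero]⟩

theorem smul_left (hF : Admissible T δ k F) (hφ : ContDiffOn ℝ k φ (puncturedCylinder n T)) :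
    Admissible T δ k (φ • F) :=
  ⟨hφ.smul hF.contDiffOn, fun p hp ht => by
    rw [Pi.smul_apply', hF.eq_zero p hp ht, smul_zero]⟩

theorem smul_right (hφ : Admissible T δ k φ) (hF : ContDiffOn ℝ k F (puncturedCylinder n T)) :
    Admissible T δ k (φ • F) :=
  ⟨hφ.contDiffOn.smul hF, fun p hp ht => by
    rw [Pi.smul_apply', hφ.eq_zero p hp ht, zero_smul]⟩

theorem const_mul (hφ : Admissible T δ k φ) (a : ℝ) : Admissible T δ k fun p => a * φ p :=
  hφ.smul_left contDiffOn_const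

theorem sq (hφ : Admissible T δ k φ) : Admissible T δ k fun p => φ p ^ 2 :=
  (hφ.smul_left hφ.contDiffOn).congr fun _ _ => pow_two _

theorem contract_left (hζ : Admissible T δ k ζ) (hη : ContDiffOn ℝ k η (puncturedCylinder n T)) :
    Admissible T δ k fun p => contract (η p) (ζ p) := by
  simp only [contract_eq_apply_sharp]
  exact ⟨hζ.contDiffOn.clm_apply (sharp.contDiff.comp_contDiffOn hη), fun p hp ht => by
    rw [hζ.eq_zero p hp ht, zero_apply]⟩

theorem apply_radial (hη : Admissible T δ k η) : Admissible T δ k fun p => η p (radial p) := by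
  simpa only [contract_radialCovector] using hη.contract_left fun p hp =>
    (contDiffAt_radialCovector (snd_ne_zero_of_mem_puncturedCylinder hp)).contDiffWithinAt

theorem apply_const (hη : Admissible T δ k η) (v : Spacetime n) :
    Admissible T δ k fun p => η p v :=
  ⟨hη.contDiffOn.clm_apply contDiffOn_const, fun p hp ht => by
    rw [hη.eq_zero p hp ht, zero_apply]⟩

theorem eventuallyEq_zero (hF : Admissible T δ k F) (hp : p ∈ puncturedCylinder n T)
    (ht : T - δ < |p.1|) : F =ᶠ[𝓝 p] 0 := by
  filter_upwards [(isOpen_puncturedCylinder n T).mem_nhds hp,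
    continuousAt_fst.abs.eventually_const_lt ht] with q hq hqt using hF.eq_zero q hq hqt

theorem minkowskiDiv (hη : Admissible T δ 1 η) : Admissible T δ 0 (minkowskiDiv η) :=
  .of_contDiffAt
    (fun _ hp => .sum fun _ _ => .sum fun _ _ => contDiffAt_const.mul <|
      (((hη.contDiffAt hp).clm_apply contDiffAt_const).fderiv_right le_rfl).clm_apply
        contDiffAt_const)
    fun _ hp ht => (minkowskiDiv_congr (hη.eventuallyEq_zero hp ht)).trans <| by
      simp [TwistedWave.minkowskiDiv]

section TwistedFields

variable {κ : ℝ} {f z u : Spacetime n → ℝ}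

theorem twistedD (hu : Admissible T δ 2 u) (κ : ℝ) : Admissible T δ 1 (twistedD κ u) :=
  .of_contDiffAt
    (fun _ hp => contDiffAt_twistedD (hu.contDiffAt hp) (snd_ne_zero_of_mem_puncturedCylinder hp)
      hp.2.2)
    fun _ hp ht => by
      rw [twistedD_eq ((hu.contDiffAt hp).differentiableAt two_ne_zero)
        (snd_ne_zero_of_mem_puncturedCylinder hp) hp.2.2, hu.eq_zero _ hp ht,
        (hu.eventuallyEq_zero hp ht).fderiv_eq]
      simp

theorem twistedWaveOp (hu : Admissible T δ 2 u) (κ : ℝ) :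
    Admissible T δ 0 (twistedWaveOp κ u) :=
  have hDu := hu.twistedD κ
  (hDu.minkowskiDiv.sub (((hDu.of_le zero_le_one).apply_radial).smul_left
    (φ := fun p => κ / yFun p) fun _ hp => (contDiffAt_const.div
      (contDiffAt_yFun (snd_ne_zero_of_mem_puncturedCylinder hp))
      (yFun_pos hp.2.2).ne').contDiffWithinAt)).congr fun _ hp =>
    twistedWaveOp_eq ((hDu.contDiffAt hp).differentiableAt one_ne_zero)
      (snd_ne_zero_of_mem_puncturedCylinder hp) hp.2.2

theorem contract_twistedD (hu : Admissible T δ 2 u) (κ : ℝ) :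
    Admissible T δ 1 fun p => contract (TwistedWave.twistedD κ u p) (TwistedWave.twistedD κ u p) :=
  (hu.twistedD κ).contract_left (hu.twistedD κ).contDiffOn

theorem multiplier (hu : Admissible T δ 2 u) (hf : ContDiffOn ℝ 2 f (puncturedCylinder n T))
    (hw : ContDiffOn ℝ 2 (wFun κ f z) (puncturedCylinder n T)) :
    Admissible T δ 1 (multiplier κ f z u) :=
  ((hu.twistedD κ).contract_left (contDiffOn_fderiv_puncturedCylinder hf)).add
    ((hu.of_le one_le_two).smul_left (hw.of_le one_le_two))

theorem energyCurrent_terms (hu : Admissible T δ 2 u)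
    (hf : ContDiffOn ℝ 2 f (puncturedCylinder n T))
    (hw : ContDiffOn ℝ 2 (wFun κ f z) (puncturedCylinder n T)) :
    Admissible T δ 1 (-TwistedWave.multiplier κ f z u • TwistedWave.twistedD κ u) ∧
      Admissible T δ 1 ((fun p => 1 / 2 * contract (TwistedWave.twistedD κ u p)
        (TwistedWave.twistedD κ u p)) • fderiv ℝ f) ∧
      Admissible T δ 1 ((fun p => 1 / 2 * u p ^ 2) • fderiv ℝ (wFun κ f z)) :=
  ⟨(hu.twistedD κ).smul_left (hu.multiplier hf hw).contDiffOn.neg,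
    ((hu.contract_twistedD κ).const_mul _).smul_right (contDiffOn_fderiv_puncturedCylinder hf),
    ((hu.of_le one_le_two).sq.const_mul _).smul_right (contDiffOn_fderiv_puncturedCylinder hw)⟩

theorem energyCurrent (hu : Admissible T δ 2 u) (hf : ContDiffOn ℝ 2 f (puncturedCylinder n T))
    (hw : ContDiffOn ℝ 2 (wFun κ f z) (puncturedCylinder n T)) :
    Admissible T δ 1 (energyCurrent κ f z u) :=
  have ⟨hDu, hdf, hdw⟩ := hu.energyCurrent_terms hf hw
  (hDu.add hdf).add hdw

theorem hardyCurrent (hu : Admissible T δ 2 u) (κ : ℝ) : Admissible T δ 1 (hardyCurrent κ u) :=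
  (((hu.of_le one_le_two).sq.smul_left (contDiffOn_yFun_rpow _ 1)).const_mul _).smul_right
    (contDiffOn_fderiv_puncturedCylinder (contDiffOn_yFun 2))

theorem gradientTerms (hu : Admissible T δ 2 u) (κ c : ℝ) :
    Admissible T δ 0 fun p => (1 - 4 * c) * ‖angularGrad u p‖ ^ 2 + 2 * c * timeDeriv u p ^ 2
      - 4 * c * TwistedWave.twistedD κ u p (radial p) ^ 2 := by
  have hDu := (hu.twistedD κ).of_le zero_le_one
  have htime := (hDu.apply_const (1, 0)).sq
  have hang := ((((hu.contract_twistedD κ).of_le zero_le_one).add htime).sub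
    hDu.apply_radial.sq).const_mul (1 - 4 * c)
  refine ((hang.add (htime.const_mul (2 * c))).sub
    (hDu.apply_radial.sq.const_mul (4 * c))).congr fun p hp => ?_
  have hdu := (hu.contDiffAt hp).differentiableAt two_ne_zero
  have hp0 := snd_ne_zero_of_mem_puncturedCylinder hp
  simp only [norm_sq_angularGrad (κ := κ) hdu hp0 hp.2.2, ← twistedD_time (κ := κ) hdu hp0 hp.2.2,
    contract_self, Pi.add_apply, Pi.sub_apply]
  ring

end TwistedFields
end Admissible

section NormalFlux

variable {n : ℕ} {T δ ε κ : ℝ} {f z u : Spacetime n → ℝ} {η ζ : Spacetime n → Spacetime n →L[ℝ] ℝ}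

theorem gammaIntegral_const_mul (T ε a : ℝ) (F : Spacetime n → ℝ) :
    gammaIntegral T ε (fun p => a * F p) = a * gammaIntegral T ε F := by
  simp only [gammaIntegral, lateralIntegral_const_mul, mul_add]

theorem normalFlux_add (hη : Admissible T δ 0 η) (hζ : Admissible T δ 0 ζ) (hδ : 0 < δ)
    (hε : 0 < ε) (hε' : ε < 1 / 2) :
    normalFlux T ε (η + ζ) = normalFlux T ε η + normalFlux T ε ζ := by
  have hlat {r : ℝ} (hr : r ∈ Icc ε (1 - ε)) :=
    hη.apply_radial.lateralIntegral_add hζ.apply_radial hδ hε hε' hr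
  simp only [normalFlux_eq hε hε', Pi.add_apply, add_apply]
  rw [hlat ⟨by linarith, le_rfl⟩, hlat ⟨le_rfl, by linarith⟩]
  ring

theorem normalFlux_energyCurrent (hu : Admissible T δ 2 u)
    (hf : ContDiffOn ℝ 2 f (puncturedCylinder n T))
    (hw : ContDiffOn ℝ 2 (wFun κ f z) (puncturedCylinder n T)) (hδ : 0 < δ) (hε : 0 < ε)
    (hε' : ε < 1 / 2) :
    normalFlux T ε (energyCurrent κ f z u) =
      -gammaIntegral T ε (fun p => multiplier κ f z u p * twistedD κ u p (outwardNormal ε p))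
        + 1 / 2 * gammaIntegral T ε (fun p =>
          fderiv ℝ f p (outwardNormal ε p) * contract (twistedD κ u p) (twistedD κ u p))
        + 1 / 2 * gammaIntegral T ε (fun p =>
          fderiv ℝ (wFun κ f z) p (outwardNormal ε p) * u p ^ 2) := by
  obtain ⟨hDu, hdf, hdw⟩ := hu.energyCurrent_terms hf hw
  rw [energyCurrent, normalFlux_add ((hDu.add hdf).of_le zero_le_one) (hdw.of_le zero_le_one)
    hδ hε hε', normalFlux_add (hDu.of_le zero_le_one) (hdf.of_le zero_le_one) hδ hε hε',
    ← neg_one_mul (gammaIntegral T ε _)]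
  simp only [normalFlux, ← gammaIntegral_const_mul]
  congr! 4 <;> simp <;> ring

theorem normalFlux_hardyCurrent (T ε κ : ℝ) (u : Spacetime n → ℝ) :
    normalFlux T ε (hardyCurrent κ u) = 2 * κ * (2 * κ - 1) * gammaIntegral T ε (fun p =>
      yFun p ^ (2 * κ - 2) * fderiv ℝ yFun p (outwardNormal ε p) * u p ^ 2) := by
  rw [normalFlux, ← gammaIntegral_const_mul]
  congr! 2
  simp only [hardyCurrent, Pi.smul_apply', smul_apply, smul_eq_mul]
  ring

end NormalFlux

section IntegratedEstimate

variable {n : ℕ} {T δ ε κ : ℝ} {u : Spacetime n → ℝ}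

theorem admissible_carlemanBulk_terms (κ : ℝ) (hu : Admissible T δ 2 u) :
    Admissible T δ 0 (fun p => yFun p ^ (2 * κ - 2) * (‖p.2‖ ^ 2)⁻¹ *
        (‖p.2‖ - ((n : ℝ) - 4) * yFun p) * u p ^ 2) ∧
      Admissible T δ 0 (fun p => yFun p ^ (2 * κ) * (‖p.2‖ ^ 3)⁻¹ * u p ^ 2) := by
  have hu0 : Admissible T δ 0 fun p => u p ^ 2 := (hu.of_le zero_le_two).sq
  have hr : ContDiffOn ℝ 0 (fun p : Spacetime n => ‖p.2‖) (puncturedCylinder n T) :=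
    contDiffOn_zero.2 continuous_snd.norm.continuousOn
  have hinv (m : ℕ) : ContDiffOn ℝ 0 (fun p : Spacetime n => (‖p.2‖ ^ m)⁻¹)
      (puncturedCylinder n T) := (hr.pow m).inv fun p hp => pow_ne_zero m hp.2.1.ne'
  exact ⟨hu0.smul_left (((contDiffOn_yFun_rpow _ 0).mul (hinv 2)).mul
    (hr.sub (contDiffOn_const.mul (contDiffOn_yFun 0)))),
    hu0.smul_left ((contDiffOn_yFun_rpow _ 0).mul (hinv 3))⟩

theorem admissible_carlemanBulk (κ c : ℝ) (hu : Admissible T δ 2 u) :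
    Admissible T δ 0 (carlemanBulk κ c u) :=
  have ⟨hfirst, hsecond⟩ := admissible_carlemanBulk_terms κ hu
  ((hu.gradientTerms κ c).sub (hfirst.const_mul _)).add (hsecond.const_mul _)

theorem setIntegral_carlemanBulk (κ c : ℝ) (hu : Admissible T δ 2 u) (hδ : 0 < δ) (hε : 0 < ε)
    (hε' : ε < 1 / 2) :
    ∫ p in cylinderEps n T ε, carlemanBulk κ c u p =
      (∫ p in cylinderEps n T ε,
        ((1 - 4 * c) * ‖angularGrad u p‖ ^ 2 + 2 * c * timeDeriv u p ^ 2
          - 4 * c * twistedD κ u p (radial p) ^ 2))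
      - (1 / 2) * ((n : ℝ) - 1) * κ *
          (∫ p in cylinderEps n T ε,
            yFun p ^ (2 * κ - 2) * (‖p.2‖ ^ 2)⁻¹ *
              (‖p.2‖ - ((n : ℝ) - 4) * yFun p) * u p ^ 2)
      + (1 / 4) * ((n : ℝ) - 1) * ((n : ℝ) - 3) *
          (∫ p in cylinderEps n T ε, yFun p ^ (2 * κ) * (‖p.2‖ ^ 3)⁻¹ * u p ^ 2) := by
  have hgrad := (hu.gradientTerms κ c).integrableOn_cylinderEps hδ hε hε'
  have ⟨hfirst, hsecond⟩ := admissible_carlemanBulk_terms κ hu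
  have hfirst := hfirst.integrableOn_cylinderEps hδ hε hε'
  have hsecond := hsecond.integrableOn_cylinderEps hδ hε hε'
  rw [← integral_const_mul, ← integral_const_mul, ← integral_sub hgrad (hfirst.const_mul _)]
  exact integral_add (hgrad.sub (hfirst.const_mul _)) (hsecond.const_mul _)

theorem setIntegral_carlemanBulk_add_normalFlux_le (hn : 1 ≤ n) (hκ : 1 + 2 * κ ≠ 0)
    (hκ' : κ ≤ 0) (c : ℝ) (hu : Admissible T δ 2 u) (hδ : 0 < δ) (hε : 0 < ε)
    (hε' : ε < 1 / 2) :
    (∫ p in cylinderEps n T ε, carlemanBulk κ c u p)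
        + normalFlux T ε (energyCurrent κ (fFun κ c) (zFun c) u)
        + normalFlux T ε (hardyCurrent κ u) ≤
      -∫ p in cylinderEps n T ε,
        twistedWaveOp κ u p * multiplier κ (fFun κ c) (zFun c) u p := by
  have hf := contDiffOn_fFun (n := n) (T := T) κ c 2
  have hw := contDiffOn_wFun (n := n) (T := T) hκ c 2
  have hE := hu.energyCurrent hf hw
  have hH := hu.hardyCurrent κ
  have hbulk := (admissible_carlemanBulk κ c hu).integrableOn_cylinderEps hδ hε hε'
  have hdivE := hE.minkowskiDiv.integrableOn_cylinderEps hδ hε hε'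
  have hdivH := hH.minkowskiDiv.integrableOn_cylinderEps hδ hε hε'
  have hwave := ((hu.twistedWaveOp κ).smul_right
    ((hu.multiplier hf hw).contDiffOn.of_le zero_le_one)).integrableOn_cylinderEps hδ hε hε'
  rw [← setIntegral_cylinderEps_minkowskiDiv hn hE hδ hε hε',
    ← setIntegral_cylinderEps_minkowskiDiv hn hH hδ hε hε', ← integral_add hbulk hdivE,
    ← integral_add (Integrable.fun_add hbulk hdivE) hdivH, ← integral_neg]
  refine setIntegral_mono_on ((hbulk.add hdivE).add hdivH) hwave.neg
    (isOpen_cylinderEps n T ε).measurableSet fun p hp => ?_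
  have hp := cylinderEps_subset_puncturedCylinder hε hp
  exact carleman_estimate hκ hκ' c (hu.contDiffAt hp) (snd_ne_zero_of_mem_puncturedCylinder hp)
    hp.2.2

end IntegratedEstimate

end TwistedWave

theorem proposition3p3_general (n : ℕ) (hn : 1 ≤ n) (T κ c : ℝ) (hκ : κ ≠ -(1 / 2)) (hκ' : κ ≤ 0)
    (u : Spacetime n → ℝ) (δ : ℝ) (hδ : 0 < δ) (hu : Admissible T δ 2 u)
    (ε : ℝ) (hε : 0 < ε) (hε' : ε < 1 / 2) :
    -(∫ p in cylinderEps n T ε,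
        twistedWaveOp κ u p * multiplier κ (fFun κ c) (zFun c) u p) ≥
      (∫ p in cylinderEps n T ε,
        ((1 - 4 * c) * ‖angularGrad u p‖ ^ 2 + 2 * c * timeDeriv u p ^ 2
          - 4 * c * twistedD κ u p (radial p) ^ 2))
      - (1 / 2) * ((n : ℝ) - 1) * κ *
          (∫ p in cylinderEps n T ε,
            yFun p ^ (2 * κ - 2) * (‖p.2‖ ^ 2)⁻¹ *
              (‖p.2‖ - ((n : ℝ) - 4) * yFun p) * u p ^ 2)
      + (1 / 4) * ((n : ℝ) - 1) * ((n : ℝ) - 3) *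
          (∫ p in cylinderEps n T ε, yFun p ^ (2 * κ) * (‖p.2‖ ^ 3)⁻¹ * u p ^ 2)
      - gammaIntegral T ε (fun p =>
          multiplier κ (fFun κ c) (zFun c) u p * twistedD κ u p (outwardNormal ε p))
      + (1 / 2) * gammaIntegral T ε (fun p =>
          fderiv ℝ (fFun κ c) p (outwardNormal ε p)
            * contract (twistedD κ u p) (twistedD κ u p))
      + (1 / 2) * gammaIntegral T ε (fun p =>
          fderiv ℝ (wFun κ (fFun κ c) (zFun c)) p (outwardNormal ε p) * u p ^ 2)
      + 2 * κ * (2 * κ - 1) * gammaIntegral T ε (fun p =>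
          yFun p ^ (2 * κ - 2) * fderiv ℝ yFun p (outwardNormal ε p) * u p ^ 2) := by
  have hκ : 1 + 2 * κ ≠ 0 := fun h => hκ (by linarith)
  have h := setIntegral_carlemanBulk_add_normalFlux_le hn hκ hκ' c hu hδ hε hε'
  rw [setIntegral_carlemanBulk κ c hu hδ hε hε', normalFlux_hardyCurrent,
    normalFlux_energyCurrent hu (contDiffOn_fFun κ c 2) (contDiffOn_wFun hκ c 2) hδ hε hε'] at h
  linarith

theorem proposition3p3 (n : ℕ) (hn : 1 ≤ n) (T κ c : ℝ) (hT : 0 < T)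
    (hκ : -(1 / 2) < κ) (hκ' : κ < 0) (hc : 0 < c)
    (u : Spacetime n → ℝ) (hu : ContDiffOn ℝ ∞ u (cylinder n T))
    (δ : ℝ) (hδ : 0 < δ)
    (hsupp : ∀ p ∈ cylinder n T, T - δ ≤ |p.1| → u p = 0)
    (ε : ℝ) (hε : 0 < ε) (hε' : ε < 1 / 2) :
    -(∫ p in cylinderEps n T ε,
        twistedWaveOp κ u p * multiplier κ (fFun κ c) (zFun c) u p) ≥
      (∫ p in cylinderEps n T ε,
        ((1 - 4 * c) * ‖angularGrad u p‖ ^ 2 + 2 * c * timeDeriv u p ^ 2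
          - 4 * c * twistedD κ u p (radial p) ^ 2))
      - (1 / 2) * ((n : ℝ) - 1) * κ *
          (∫ p in cylinderEps n T ε,
            yFun p ^ (2 * κ - 2) * (‖p.2‖ ^ 2)⁻¹ *
              (‖p.2‖ - ((n : ℝ) - 4) * yFun p) * u p ^ 2)
      + (1 / 4) * ((n : ℝ) - 1) * ((n : ℝ) - 3) *
          (∫ p in cylinderEps n T ε, yFun p ^ (2 * κ) * (‖p.2‖ ^ 3)⁻¹ * u p ^ 2)
      - gammaIntegral T ε (fun p =>
          multiplier κ (fFun κ c) (zFun c) u p * twistedD κ u p (outwardNormal ε p))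
      + (1 / 2) * gammaIntegral T ε (fun p =>
          fderiv ℝ (fFun κ c) p (outwardNormal ε p)
            * contract (twistedD κ u p) (twistedD κ u p))
      + (1 / 2) * gammaIntegral T ε (fun p =>
          fderiv ℝ (wFun κ (fFun κ c) (zFun c)) p (outwardNormal ε p) * u p ^ 2)
      + 2 * κ * (2 * κ - 1) * gammaIntegral T ε (fun p =>
          yFun p ^ (2 * κ - 2) * fderiv ℝ yFun p (outwardNormal ε p) * u p ^ 2) := by
  refine proposition3p3_general n hn T κ c hκ.ne' hκ'.le u δ hδ ⟨?_, fun p hp ht => ?_⟩ ε hε hε'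
  · exact (hu.of_le ENat.LEInfty.out).mono fun p hp => ⟨hp.1, hp.2.2⟩
  · exact hsupp p ⟨hp.1, hp.2.2⟩ ht.le
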